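/- **Setting.** There are $k\ge 1$ sites and a server. Events arrive one at a time, each at one site; $n_i$ is the number of events received so far at site $i$, and $n=\sum_i n_i$. Messages are delivered instantly. Write $\mathrm{Geom}(q)$ for the geometric law on $\{1,2,\dots\}$ with success probability $q$. **The HYZ12 protocol** with parameters $k$ and $\varepsilon>0$. The server keeps, for each site $i$, an adjusted last report $\bar n_i$ and an estimate $\hat n_i$, both initially $0$; a transmission probability $p$, initially $1$ and known to all sites; and a published estimate $\hat n$, initially $0$. It also keeps last notified counts $n_i'=0$, their total $n'=0$ and a threshold $\tau=1$. When an event arrives at site $i$, $n_i$ increases by $1$ and the following happens in this order. 1. With probability $p$, independently of everything else, site $i$ reports $n_i$. The server then sets $\bar n_i\leftarrow n_i$ and $\hat n_i\leftarrow \bar n_i-1+1/p$, and publishes $\hat n\leftarrow\sum_j\hat n_j$. 2. If $n_i$ is a power of $2$, the server sets $n'\leftarrow n'+n_i-n_i'$ and $n_i'\leftarrow n_i$. If now $n'\ge 2\tau$, it sets $\tau\leftarrow n'$ and starts a new round: $p_{\mathrm{old}}\leftarrow p$ and $p\leftarrow 2^{\min\{0,\lfloor\log_2(\sqrt k/(\varepsilon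 n'))\rfloor\}}$, and, if $p<1$, for every site $j$ independently it samples $B\sim\mathrm{Bernoulli}(1-p/p_{\mathrm{old}})$ and $G\sim\mathrm{Geom}(p)$, independent of each other, sets $\bar n_j\leftarrow\max\{0,\bar n_j-BG\}$, and sets $\hat n_j\leftarrow 0$ if $\bar n_j=0$ and $\hat n_j\leftarrow\bar n_j-1+1/p$ otherwise. **The attack.** The following deterministic adaptive adversary sees only the published estimate, before the first event and after every event. It injects events at the current site (initially site $1$) until the published estimate changes, and then moves to the next site in cyclic order. **Theorem.** There are universal constants $c_1,c_2,c_3>0$ such that for all integers $k\ge1$, all $0<\varepsilon\le 1/\sqrt k$ and every event count $n>c_3\sqrt k/\varepsilon$, when HYZ12 is run against this attack, the published estimate $\hat n$ after $n$ events satisfies $$\Pr\bigl[\hat n-n>c_1\sqrt k\,\varepsilon n\bigr]\ \ge\ 1-e^{-c_2k},$$ and so does the current sum $\sum_i\hat n_i$ of the server's per-site estimates: $$\Pr\Bigl[\sum_i\hat n_i-n>c_1\sqrt k\,\varepsilon n\Bigr]\ \ge\ 1-e^{-c_2k}.$$ In particular the relative error is $\Omega(\sqrt k)$ times the target $\varepsilon$,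 with probability at least $1-e^{-c_2k}$. -/

import Mathlib

noncomputable section

namespace DistributedCounting

/-- A transmission probability: a real number `p` with `0 < p ≤ 1`. -/
abbrev TransmitProb : Type := Set.Ioc (0 : ℝ) 1

theorem hasSum_geom (q : TransmitProb) :
    HasSum (fun j : ℕ => if j = 0 then 0 else ENNReal.ofReal ((1 - (q : ℝ)) ^ (j - 1) * q)) 1 := by
  have h0 : 0 ≤ 1 - (q : ℝ) := sub_nonneg.mpr q.2.2
  have h1 : 1 - (q : ℝ) < 1 := sub_lt_self 1 q.2.1
  have h : HasSum (fun j : ℕ => (1 - (q : ℝ)) ^ j * q) 1 := by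
    have h' := (hasSum_geometric_of_lt_one h0 h1).mul_right (q : ℝ)
    rwa [sub_sub_cancel, inv_mul_cancel₀ q.2.1.ne'] at h'
  rw [ENNReal.summable.hasSum_iff, tsum_eq_zero_add' ENNReal.summable]
  simp only [if_true, Nat.succ_ne_zero, if_false, Nat.add_sub_cancel, zero_add]
  rw [← ENNReal.ofReal_tsum_of_nonneg (fun j => mul_nonneg (pow_nonneg h0 j) q.2.1.le) h.summable,
    h.tsum_eq, ENNReal.ofReal_one]

/-- The geometric law on `{1, 2, …}` with `Pr[G = j] = (1 - q) ^ (j - 1) * q`. -/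
def geom (q : TransmitProb) : PMF ℕ :=
  ⟨fun j => if j = 0 then 0 else ENNReal.ofReal ((1 - (q : ℝ)) ^ (j - 1) * q), hasSum_geom q⟩

/-- `Bernoulli(u)`, with `true` for the outcome `1`. -/
def coin (u : unitInterval) : PMF Bool :=
  PMF.ofFintype (fun b => if b then ENNReal.ofReal u else ENNReal.ofReal (1 - u)) <| by
    simp [← ENNReal.ofReal_add u.2.1 (sub_nonneg.mpr u.2.2)]

/-- The zero-inflated geometric law of `Z = B * G`, for independent `B ∼ Bernoulli(1 - q / p)` and
`G ∼ Geom(q)`, where `q ≤ p` (so that `1 - q / p` lies in `[0, 1]` and the projection to `[0, 1]`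
leaves it unchanged). -/
def zeroInflatedGeom (q p : TransmitProb) : PMF ℕ :=
  (coin (Set.projIcc (0 : ℝ) 1 zero_le_one (1 - (q : ℝ) / (p : ℝ)))).bind
    fun B => (geom q).bind fun G => PMF.pure (if B then G else 0)

/-- `2 ^ min {0, ⌊log₂ (√k / (ε n'))⌋}`, the transmission probability chosen by the server when the
doubling protocol announces the approximate total count `n'`. -/
def transmitProb (k : ℕ) (ε : ℝ) (n' : ℕ) : TransmitProb :=
  ⟨(2 : ℝ) ^ min (0 : ℤ) ⌊Real.logb 2 (Real.sqrt k / (ε * n'))⌋,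
    zpow_pos two_pos _, zpow_le_one_of_nonpos₀ one_le_two (min_le_left _ _)⟩

/-- Joint state of the `k` sites and the server. Messages are delivered instantly, so the sites'
local copies of the transmission probability always equal the server's value `p`. -/
structure State (k : ℕ) where
  /-- `n i`: number of events received by site `i` -/
  n : Fin k → ℕ
  /-- doubling protocol, server: last count `n'ᵢ` notified by site `i` -/
  notified : Fin k → ℕ
  /-- doubling protocol, server: the approximate total count `n'` -/
  approx : ℕ
  /-- doubling protocol, server: the threshold `τ` -/
  threshold : ℕ
  /-- current transmission probability -/
  p : TransmitProb
  /-- server: the (adjusted) last report of site `i` -/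
  nbar : Fin k → ℕ
  /-- server: the estimate of the count of site `i` -/
  nhat : Fin k → ℝ
  /-- the last value of the total estimate that the server has published -/
  published : ℝ

namespace State

variable {k : ℕ}

/-- The state before the first event. -/
def init (k : ℕ) : State k where
  n := fun _ => 0
  notified := fun _ => 0
  approx := 0
  threshold := 1
  p := ⟨1, one_pos, le_rfl⟩
  nbar := fun _ => 0
  nhat := fun _ => 0
  published := 0

/-- The sum of the server's current per-site estimates. -/
def sumEstimate (s : State k) : ℝ := ∑ j, s.nhat j

/-- Site `i` increments its local counter. -/
def countEvent (s : State k) (i : Fin k) : State k :=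
  { s with n := Function.update s.n i (s.n i + 1) }

/-- The server receives a report of the exact local count from site `i`: it updates the estimate
for site `i` and publishes the new total estimate. -/
def report (s : State k) (i : Fin k) : State k :=
  let nhat' := Function.update s.nhat i ((s.n i : ℝ) - 1 + 1 / (s.p : ℝ))
  { s with
    nbar := Function.update s.nbar i (s.n i)
    nhat := nhat'
    published := ∑ j, nhat' j }

/-- Doubling protocol: the server receives from site `i` the notification of its local count. -/
def doublingNotify (s : State k) (i : Fin k) : State k :=
  { s with
    approx := s.approx + (s.n i - s.notified i)
    notified := Function.update s.notified i (s.n i) }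

/-- Given a sample `Z`, replace the last report of site `i` by `max {0, nbar i - Z}` (which is
truncated subtraction) and recompute the estimate for site `i`. -/
def adjust (s : State k) (i : Fin k) (Z : ℕ) : State k :=
  { s with
    nbar := Function.update s.nbar i (s.nbar i - Z)
    nhat := Function.update s.nhat i
      (if s.nbar i - Z = 0 then 0 else ((s.nbar i - Z : ℕ) : ℝ) - 1 + 1 / (s.p : ℝ)) }

/-- The loop over the listed sites, adjusting each of them with a fresh sample `Z ∼ Z_{p, pold}`. -/
def adjustAll (pold : TransmitProb) : List (Fin k) → State k → PMF (State k)
  | [], s => PMF.pure s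
  | i :: l, s => (zeroInflatedGeom s.p pold).bind fun Z => adjustAll pold l (s.adjust i Z)

/-- A new round: the server sets the threshold and the transmission probability from the approximate
total count; if the transmission probability is below `1`, it adjusts the estimates of all sites. -/
def newRound (ε : ℝ) (s : State k) : PMF (State k) :=
  let s' : State k := { s with threshold := s.approx, p := transmitProb k ε s.approx }
  if (s'.p : ℝ) < 1 then adjustAll s.p (List.finRange k) s' else PMF.pure s'

open Classical in
/-- The protocol's reaction to one event at site `i`: the site reports its count with probability
`p`; if the count is a power of two it sends a doubling notification, and if this makes the
approximate total count reach twice the threshold, a new round starts (after the report, if any,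
has been processed). -/
def event (ε : ℝ) (s : State k) (i : Fin k) : PMF (State k) :=
  let s₁ := s.countEvent i
  (coin ⟨s₁.p, s₁.p.2.1.le, s₁.p.2.2⟩).bind fun X =>
    let s₂ := if X then s₁.report i else s₁
    if ∃ j : ℕ, s₁.n i = 2 ^ j then
      let s₃ := s₂.doublingNotify i
      if 2 * s₃.threshold ≤ s₃.approx then newRound ε s₃ else PMF.pure s₃
    else PMF.pure s₂

end State

/-- A deterministic adaptive adversary for `k` sites: all it learns about the execution is the
published estimate, which it observes before the first event and after every event. -/
structure Adversary (k : ℕ) where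
  /-- memory states -/
  Memory : Type
  /-- memory after the initial observation -/
  start : ℝ → Memory
  /-- the site at which the next event is injected -/
  site : Memory → Fin k
  /-- memory update upon the observation that follows an event -/
  observe : Memory → ℝ → Memory

/-- Law of the protocol state and the adversary's memory after `t` injected events. -/
def run {k : ℕ} (ε : ℝ) (A : Adversary k) : ℕ → PMF (State k × A.Memory)
  | 0 => PMF.pure (State.init k, A.start (State.init k).published)
  | t + 1 => (run ε A t).bind fun x =>
      ((x.1).event ε (A.site x.2)).map fun s => (s, A.observe x.2 s.published)

/-- The round-robin attack. The memory holds the current site and the last recorded estimate. Events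
are injected at the current site until the observed estimate differs from the recorded one; then
the new estimate is recorded and the attack moves to the cyclically next site. -/
def roundRobinAttack (k : ℕ) [NeZero k] : Adversary k where
  Memory := Fin k × ℝ
  start := fun est => (0, est)
  site := fun m => m.1
  observe := fun m est => if est = m.2 then m else (m.1 + 1, est)

end DistributedCounting

end

/-!
The attack leaves a site only right after this site has reported, and the estimate for a site is
then `1 / p - 1` above its count, the largest possible error. The adjustments of this estimate in
later rounds are unbiased, so that the total error after `n` events is of the order of the number
of visited sites times `1 / p`, that is `k * n / (√k / ε) = √k * ε * n`, since the transmission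
probability `p` is of the order of `√k / (ε * n)` during the second half of the events
(`State.Valid.p_le`, `State.Consistent.le_p`). The obstacle is that each new round moves the last
reports back at random, and that a large deviation bound is wanted. With many sites, the
probability of failure is exponentially small; with few sites, a lower bound on the probability of
success that depends on the number of sites is enough, because `c₂` can be chosen small.

**Many sites.** Moving a last report back when the transmission probability drops to `q` is
unbiased, and `expect_exp_adjust_le` bounds its effect on the exponential moment of parameter `l`
by `exp (2 * (l / q) ^ 2)`. As `p` is at least halved in each round in which it changes, the total
cost of all rounds is at most of order `k * (l / p) ^ 2`, the `discount`. So the discounted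
exponential moment of the negative error is a supermartingale if the error of the current site,
which runs down between its reports, is replaced by its value `1 / p - 1` right after a report
(`expect_settle_potential_le`, `expect_step_potential_le`). The events are divided into three
phases.
* In the first one, the errors of the `q - 1` sites, a small fraction of `k`, that lie ahead of the
  attack at its end are replaced by `0`; a union bound over the current site removes the dependence
  of these sites on the run.
* In the second one they are replaced by a fixed fraction `g` of `n / (√k / ε)`, which gains a
  factor `exp (-l * g * (q - 1))`. If the attack visits all of them, this is a valid lower bound
  for their errors at the times of the visits (`expect_stepN_potential_le`), and it fails to do so
  only with exponentially small probability (`expect_stepN_moves_le`). A report fails to move the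
  attack only if it leaves the published estimate unchanged, which needs the sum of the estimates
  to have been adjusted since the last report; `moveWeight` accounts for this.
* In the last one the virtual error of the current site is turned into the true one: the potential
  bounds the error of the published estimate, or of the sum of the estimates, at the last report,
  and it is unlikely that many events have passed since (`expect_stepN_estPotential_le`).

Markov's inequality then gives `expect_small_error_le`.

**Few sites.** With a probability of at least `(p' / p) ^ k`, no last report is moved back when the
transmission probability drops from `p` to `p'` (`State.exists_le_settle`), and these factors
telescope. If moreover at least `k + 5` reports occur in a stretch of `n / 4` events near the end,
then the attack has gone round all sites, so that all but the current one are without unreported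
events; a further report in the last `w` events, where `w` is a small multiple of `n / (√k / ε)`,
makes both estimates exceed the count before these events by at least `k * (1 / p - 1)`, which is
larger than `w` by a multiple of `n / (√k / ε)`. This is `le_expect_large_error`.
-/

noncomputable section

open scoped ENNReal

namespace DistributedCounting

/-! ### Expectations under probability mass functions -/

/-- The expectation of an extended nonnegative function under a probability mass function. -/
def expect {α : Type*} (μ : PMF α) (f : α → ℝ≥0∞) : ℝ≥0∞ := ∑' x, μ x * f x

section Expect

variable {α β : Type*}

theorem expect_pure (a : α) (f : α → ℝ≥0∞) : expect (PMF.pure a) f = f a := by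
  unfold expect
  rw [tsum_eq_single a]
  · simp
  · intro b hb
    simp [PMF.pure_apply, hb]

theorem expect_bind (μ : PMF α) (κ : α → PMF β) (f : β → ℝ≥0∞) :
    expect (μ.bind κ) f = expect μ fun a => expect (κ a) f := by
  unfold expect
  simp only [PMF.bind_apply, ← ENNReal.tsum_mul_right, ← ENNReal.tsum_mul_left]
  rw [ENNReal.tsum_comm]
  simp only [mul_assoc]

theorem expect_map (μ : PMF α) (g : α → β) (f : β → ℝ≥0∞) :
    expect (μ.map g) f = expect μ fun a => f (g a) := by
  rw [PMF.map, expect_bind]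
  simp only [Function.comp_apply, expect_pure]

theorem expect_mono {μ : PMF α} {f g : α → ℝ≥0∞} (h : ∀ x ∈ μ.support, f x ≤ g x) :
    expect μ f ≤ expect μ g := by
  refine ENNReal.tsum_le_tsum fun x => ?_
  by_cases hx : μ x = 0
  · simp [hx]
  · exact mul_le_mul_right (h x ((PMF.mem_support_iff _ _).2 hx)) _

theorem expect_congr {μ : PMF α} {f g : α → ℝ≥0∞} (h : ∀ x ∈ μ.support, f x = g x) :
    expect μ f = expect μ g :=
  le_antisymm (expect_mono fun x hx => (h x hx).le) (expect_mono fun x hx => (h x hx).ge)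

theorem expect_const (μ : PMF α) (c : ℝ≥0∞) : (expect μ fun _ => c) = c := by
  unfold expect
  rw [ENNReal.tsum_mul_right, PMF.tsum_coe, one_mul]

theorem expect_add (μ : PMF α) (f g : α → ℝ≥0∞) :
    (expect μ fun x => f x + g x) = expect μ f + expect μ g := by
  unfold expect
  simp only [mul_add]
  exact ENNReal.tsum_add

theorem expect_const_mul (μ : PMF α) (c : ℝ≥0∞) (f : α → ℝ≥0∞) :
    (expect μ fun x => c * f x) = c * expect μ f := by
  unfold expect
  rw [← ENNReal.tsum_mul_left]
  exact tsum_congr fun x => by ring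

theorem expect_finset_sum {ι : Type*} (μ : PMF α) (s : Finset ι) (f : ι → α → ℝ≥0∞) :
    (expect μ fun x => ∑ i ∈ s, f i x) = ∑ i ∈ s, expect μ (f i) := by
  classical
  induction s using Finset.induction_on with
  | empty => simp [expect]
  | insert a s ha ih =>
    simp only [Finset.sum_insert ha]
    rw [expect_add, ih]

theorem apply_mul_le_expect (μ : PMF α) (f : α → ℝ≥0∞) (a : α) : μ a * f a ≤ expect μ f :=
  ENNReal.le_tsum (f := fun x => μ x * f x) a

theorem toOuterMeasure_eq_expect (μ : PMF α) (s : Set α) :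
    μ.toOuterMeasure s = expect μ (s.indicator 1) := by
  rw [PMF.toOuterMeasure_apply]
  unfold expect
  refine tsum_congr fun x => ?_
  by_cases hx : x ∈ s <;> simp [hx]

theorem expect_coin (u : unitInterval) (f : Bool → ℝ≥0∞) :
    expect (coin u) f
      = ENNReal.ofReal u * f true + ENNReal.ofReal (1 - (u : ℝ)) * f false := by
  unfold expect
  rw [tsum_fintype]
  simp [coin]

end Expect

/-! ### The geometric law and the adjustment of a report -/

theorem expect_geom (q : TransmitProb) (f : ℕ → ℝ≥0∞) :
    expect (geom q) f
      = ∑' j : ℕ, ENNReal.ofReal ((1 - (q : ℝ)) ^ j * q) * f (j + 1) := by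
  unfold expect
  rw [tsum_eq_zero_add' ENNReal.summable]
  have h0 : geom q 0 = 0 := by
    change (if (0 : ℕ) = 0 then (0 : ℝ≥0∞)
      else ENNReal.ofReal ((1 - (q : ℝ)) ^ (0 - 1) * q)) = 0
    simp
  rw [h0, zero_mul, zero_add]
  refine tsum_congr fun j => ?_
  have h1 : geom q (j + 1) = ENNReal.ofReal ((1 - (q : ℝ)) ^ j * q) := by
    change (if j + 1 = 0 then (0 : ℝ≥0∞)
      else ENNReal.ofReal ((1 - (q : ℝ)) ^ (j + 1 - 1) * q)) = _
    simp
  rw [h1]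

/-- The geometric law is memoryless. -/
theorem expect_geom_succ (q : TransmitProb) (f : ℕ → ℝ≥0∞) :
    expect (geom q) f = ENNReal.ofReal q * f 1
      + ENNReal.ofReal (1 - (q : ℝ)) * expect (geom q) fun g => f (g + 1) := by
  have h0 : 0 ≤ 1 - (q : ℝ) := sub_nonneg.mpr q.2.2
  rw [expect_geom q f, expect_geom q, tsum_eq_zero_add' ENNReal.summable, ← ENNReal.tsum_mul_left]
  congr 1
  · simp
  · refine tsum_congr fun j => ?_
    rw [← mul_assoc, ← ENNReal.ofReal_mul h0]
    congr 2
    ring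

/-- The server's estimate of a local count, from a last report `r` (where `r = 0` stands for no
report) and the transmission probability `q`. -/
def siteEstimate (q : ℝ) (r : ℕ) : ℝ := if r = 0 then 0 else (r : ℝ) - 1 + 1 / q

theorem siteEstimate_zero (q : ℝ) : siteEstimate q 0 = 0 := by simp [siteEstimate]

theorem siteEstimate_succ (q : ℝ) (r : ℕ) : siteEstimate q (r + 1) = r + 1 / q := by
  simp [siteEstimate]

theorem siteEstimate_nonneg {q : ℝ} (hq : 0 < q) (r : ℕ) : 0 ≤ siteEstimate q r := by
  cases r with
  | zero => simp [siteEstimate]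
  | succ r => rw [siteEstimate_succ]; positivity

theorem siteEstimate_le {q : ℝ} (hq : 0 < q) (hq1 : q ≤ 1) (r : ℕ) :
    siteEstimate q r ≤ r + (1 / q - 1) := by
  cases r with
  | zero =>
    rw [siteEstimate_zero]
    have := (one_le_div hq).2 hq1
    push_cast; linarith
  | succ r => rw [siteEstimate_succ]; push_cast; linarith

/-- Moving a last report back by a geometric number of events changes the exponential moment of
the estimate by a factor of at most `1 / (1 - l / q)`. -/
theorem expect_geom_exp_siteEstimate_le (q : TransmitProb) {l : ℝ}
    (hlq : l < q) (m : ℕ) :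
    (expect (geom q) fun g =>
        ENNReal.ofReal (Real.exp (-l * siteEstimate q (m + 1 - g))))
      ≤ ENNReal.ofReal (Real.exp (-l * siteEstimate q (m + 1)) * (1 - l / q)⁻¹) := by
  have hq : 0 < (q : ℝ) := q.2.1
  have hq1 : 0 ≤ 1 - (q : ℝ) := sub_nonneg.2 q.2.2
  have hx : 0 < 1 - l / q := sub_pos.2 ((div_lt_one hq).2 hlq)
  induction m with
  | zero =>
    have : (fun g : ℕ => ENNReal.ofReal (Real.exp (-l * siteEstimate q (0 + 1 - (g + 1))))) =
        fun _ => 1 := by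
      funext g
      have : 0 + 1 - (g + 1) = 0 := by omega
      rw [this]; simp [siteEstimate_zero]
    rw [expect_geom_succ, this, expect_const]
    simp only [zero_add, Nat.sub_self, siteEstimate_zero, mul_zero, Real.exp_zero,
      ENNReal.ofReal_one, mul_one]
    rw [← ENNReal.ofReal_add hq.le hq1]
    apply ENNReal.ofReal_le_ofReal
    have h1 : siteEstimate q 1 = 1 / q := by simpa using siteEstimate_succ q 0
    rw [h1, add_sub_cancel, ← div_eq_mul_inv, le_div_iff₀ hx]
    have := Real.add_one_le_exp (-l * (1 / q))
    have h2 : -l * (1 / (q : ℝ)) = -(l / q) := by ring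
    rw [h2] at this ⊢
    linarith
  | succ m ih =>
    rw [expect_geom_succ]
    have h1 : m + 1 + 1 - 1 = m + 1 := rfl
    have h2 : ∀ g, m + 1 + 1 - (g + 1) = m + 1 - g := fun g => by omega
    simp only [h1, h2]
    calc _ ≤ ENNReal.ofReal q * ENNReal.ofReal (Real.exp (-l * siteEstimate q (m + 1)))
          + ENNReal.ofReal (1 - q)
            * ENNReal.ofReal (Real.exp (-l * siteEstimate q (m + 1)) * (1 - l / q)⁻¹) := by
          gcongr
      _ ≤ _ := by
          rw [← ENNReal.ofReal_mul hq.le, ← ENNReal.ofReal_mul hq1, ← ENNReal.ofReal_add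
            (by positivity) (by positivity)]
          apply ENNReal.ofReal_le_ofReal
          rw [siteEstimate_succ q (m + 1), siteEstimate_succ q m]
          have h3 : -l * (((m + 1 : ℕ) : ℝ) + 1 / q) = -l * (m + 1 / q) + -l := by
            push_cast; ring
          rw [h3, Real.exp_add]
          have h4 := Real.add_one_le_exp (-l)
          have h5 : (q : ℝ) * (1 - l / q) + (1 - q) ≤ Real.exp (-l) := by
            have : (q : ℝ) * (1 - l / q) = q - l := by field_simp
            rw [this]; linarith
          have h6 := mul_le_mul_of_nonneg_left h5
            (show 0 ≤ Real.exp (-l * (m + 1 / q)) * (1 - l / q)⁻¹ by positivity)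
          have h7 : Real.exp (-l * (m + 1 / q)) * (1 - l / q)⁻¹ * ((q : ℝ) * (1 - l / q) + (1 - q))
              = q * Real.exp (-l * (m + 1 / q))
                + (1 - q) * (Real.exp (-l * (m + 1 / q)) * (1 - l / q)⁻¹) := by
            rw [mul_add, show ∀ a b : ℝ, a * b⁻¹ * (q * b) = q * a * (b⁻¹ * b) by
              intros; ring, inv_mul_cancel₀ hx.ne']
            ring
          rw [← h7]
          refine h6.trans (le_of_eq ?_)
          ring

theorem expect_zeroInflatedGeom (q p : TransmitProb) (hqp : (q : ℝ) ≤ p) (f : ℕ → ℝ≥0∞) :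
    expect (zeroInflatedGeom q p) f
      = ENNReal.ofReal (1 - q / p) * expect (geom q) f + ENNReal.ofReal (q / p) * f 0 := by
  have hp : 0 < (p : ℝ) := p.2.1
  have h1 : (q : ℝ) / p ≤ 1 := (div_le_one hp).2 hqp
  have h2 : 0 ≤ (q : ℝ) / p := div_nonneg q.2.1.le hp.le
  have hmem : 1 - (q : ℝ) / p ∈ Set.Icc (0 : ℝ) 1 := ⟨by linarith, by linarith⟩
  unfold zeroInflatedGeom
  rw [expect_bind, expect_coin, Set.projIcc_of_mem zero_le_one hmem]
  simp only [expect_bind, expect_pure, if_true, Bool.false_eq_true, if_false, expect_const,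
    sub_sub_cancel]

/-- The adjustment of the last report of a site when the transmission probability drops from `p`
to `q`, which is unbiased, costs only a second-order factor in the exponential moment. -/
theorem expect_exp_adjust_le (q p : TransmitProb) (hqp : (q : ℝ) ≤ p) {l : ℝ} (hl : 0 ≤ l)
    (hlq : l ≤ q / 2) (m : ℕ) :
    (expect (zeroInflatedGeom q p) fun Z =>
        ENNReal.ofReal (Real.exp (-l * siteEstimate q (m - Z))))
      ≤ ENNReal.ofReal (Real.exp (2 * (l / q) ^ 2) * Real.exp (-l * siteEstimate p m)) := by
  have hq : 0 < (q : ℝ) := q.2.1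
  have hp : 0 < (p : ℝ) := p.2.1
  cases m with
  | zero =>
    simp only [Nat.zero_sub, siteEstimate_zero, mul_zero, Real.exp_zero, ENNReal.ofReal_one,
      mul_one, expect_const]
    rw [← ENNReal.ofReal_one]
    apply ENNReal.ofReal_le_ofReal
    exact Real.one_le_exp (by positivity)
  | succ m =>
    have hx0 : 0 ≤ l / q := by positivity
    have hx1 : l / q ≤ 1 / 2 := by rw [div_le_iff₀ hq]; linarith
    have hr0 : 0 ≤ (q : ℝ) / p := by positivity
    have hr1 : (q : ℝ) / p ≤ 1 := (div_le_one hp).2 hqp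
    have hx : 0 < 1 - l / q := by linarith
    rw [expect_zeroInflatedGeom q p hqp]
    refine (add_le_add_left (mul_le_mul_right
      (expect_geom_exp_siteEstimate_le q (by linarith) m) _) _).trans ?_
    rw [← ENNReal.ofReal_mul (by linarith), ← ENNReal.ofReal_mul hr0, ← ENNReal.ofReal_add
      (mul_nonneg (by linarith) (by positivity)) (by positivity)]
    apply ENNReal.ofReal_le_ofReal
    simp only [Nat.sub_zero]
    rw [siteEstimate_succ, siteEstimate_succ]
    set x : ℝ := l / q with hxdef
    set r : ℝ := (q : ℝ) / p with hrdef
    have e1 : -l * (m + 1 / (q : ℝ)) = -l * (m + 1 / p) + -(x * (1 - r)) := by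
      rw [hxdef, hrdef]; field_simp; ring
    rw [e1, Real.exp_add]
    have e2 : (1 - r) * (1 - x)⁻¹ + r = 1 + (1 - r) * x / (1 - x) := by
      field_simp; ring
    have e3 : 1 + (1 - r) * x / (1 - x) ≤ Real.exp ((1 - r) * x / (1 - x)) := by
      have := Real.add_one_le_exp ((1 - r) * x / (1 - x)); linarith
    have e4 : -(x * (1 - r)) + (1 - r) * x / (1 - x) ≤ 2 * x ^ 2 := by
      have : -(x * (1 - r)) + (1 - r) * x / (1 - x) = (1 - r) * (x ^ 2 / (1 - x)) := by
        field_simp; ring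
      rw [this]
      have h1 : x ^ 2 / (1 - x) ≤ 2 * x ^ 2 := by
        rw [div_le_iff₀ hx]; nlinarith [sq_nonneg x]
      have h2 : 0 ≤ x ^ 2 / (1 - x) := by positivity
      nlinarith
    calc _ = Real.exp (-l * (m + 1 / p)) * (Real.exp (-(x * (1 - r)))
            * ((1 - r) * (1 - x)⁻¹ + r)) := by ring
      _ ≤ Real.exp (-l * (m + 1 / p)) * (Real.exp (-(x * (1 - r)))
            * Real.exp ((1 - r) * x / (1 - x))) := by
          rw [e2]; gcongr
      _ = Real.exp (-l * (m + 1 / p)) * Real.exp (-(x * (1 - r)) + (1 - r) * x / (1 - x)) := by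
          rw [Real.exp_add]
      _ ≤ Real.exp (-l * (m + 1 / p)) * Real.exp (2 * x ^ 2) := by gcongr
      _ = _ := by ring

theorem ofReal_le_zeroInflatedGeom_zero (q p : TransmitProb) (hqp : (q : ℝ) ≤ p) :
    ENNReal.ofReal (q / p) ≤ zeroInflatedGeom q p 0 := by
  have h := expect_zeroInflatedGeom q p hqp (fun Z => if Z = 0 then 1 else 0)
  have h1 : expect (zeroInflatedGeom q p) (fun Z => if Z = 0 then 1 else 0)
      = zeroInflatedGeom q p 0 := by
    unfold expect
    rw [tsum_eq_single 0]
    · simp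
    · intro b hb; simp [hb]
  rw [← h1, h]
  simp

/-! ### The transmission probability as a function of the announced total -/

section TransmitProb

variable {k : ℕ} {ε : ℝ}

theorem transmitProb_le (hR : 0 < Real.sqrt k / ε) {τ : ℕ} (hτ : 0 < τ) :
    (transmitProb k ε τ : ℝ) ≤ Real.sqrt k / ε / τ := by
  have hτ' : (0 : ℝ) < τ := by exact_mod_cast hτ
  have hpos : 0 < Real.sqrt k / (ε * τ) := by rw [← div_div]; positivity
  rw [div_div]
  change (2 : ℝ) ^ min (0 : ℤ) ⌊Real.logb 2 (Real.sqrt k / (ε * τ))⌋ ≤ _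
  calc _ ≤ (2 : ℝ) ^ ⌊Real.logb 2 (Real.sqrt k / (ε * τ))⌋ :=
        zpow_le_zpow_right₀ one_le_two (min_le_right _ _)
    _ = (2 : ℝ) ^ ((⌊Real.logb 2 (Real.sqrt k / (ε * τ))⌋ : ℤ) : ℝ) := (Real.rpow_intCast _ _).symm
    _ ≤ (2 : ℝ) ^ Real.logb 2 (Real.sqrt k / (ε * τ)) :=
        Real.rpow_le_rpow_of_exponent_le one_le_two (Int.floor_le _)
    _ = _ := Real.rpow_logb two_pos (by norm_num) hpos

theorem le_transmitProb (hR : 0 < Real.sqrt k / ε) {τ N : ℕ} (hτ : 0 < τ) (hτN : τ ≤ N)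
    (hN : Real.sqrt k / ε ≤ 2 * N) :
    Real.sqrt k / ε / (2 * N) ≤ transmitProb k ε τ := by
  have hτ' : (0 : ℝ) < τ := by exact_mod_cast hτ
  have hτN' : (τ : ℝ) ≤ N := by exact_mod_cast hτN
  have hpos : 0 < Real.sqrt k / (ε * τ) := by rw [← div_div]; positivity
  change _ ≤ (2 : ℝ) ^ min (0 : ℤ) ⌊Real.logb 2 (Real.sqrt k / (ε * τ))⌋
  rcases le_total (0 : ℤ) ⌊Real.logb 2 (Real.sqrt k / (ε * τ))⌋ with h | h
  · rw [min_eq_left h, zpow_zero]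
    exact (div_le_one (by linarith)).2 hN
  · rw [min_eq_right h]
    calc Real.sqrt k / ε / (2 * N) ≤ Real.sqrt k / ε / (2 * τ) := by gcongr
      _ = (2 : ℝ) ^ (Real.logb 2 (Real.sqrt k / (ε * τ)) - 1) := by
        rw [Real.rpow_sub two_pos, Real.rpow_logb two_pos (by norm_num) hpos, Real.rpow_one,
          div_div, div_div]
        congr 1
        ring
      _ ≤ (2 : ℝ) ^ ((⌊Real.logb 2 (Real.sqrt k / (ε * τ))⌋ : ℤ) : ℝ) :=
        Real.rpow_le_rpow_of_exponent_le one_le_two (Int.sub_one_lt_floor _).le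
      _ = _ := Real.rpow_intCast _ _

/-- When the announced total at least doubles and the new transmission probability is below `1`,
the transmission probability is at least halved. -/
theorem transmitProb_le_half (hR : 0 < Real.sqrt k / ε) {τ τ' : ℕ} (hτ : 0 < τ)
    (h : 2 * τ ≤ τ') (h1 : (transmitProb k ε τ' : ℝ) < 1) :
    (transmitProb k ε τ' : ℝ) ≤ transmitProb k ε τ / 2 := by
  have hτ0 : (0 : ℝ) < τ := by exact_mod_cast hτ
  have hτ1 : (2 : ℝ) * τ ≤ τ' := by exact_mod_cast h
  have hτ' : (0 : ℝ) < τ' := by linarith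
  have hpos : 0 < Real.sqrt k / (ε * τ) := by rw [← div_div]; positivity
  have hpos' : 0 < Real.sqrt k / (ε * τ') := by rw [← div_div]; positivity
  change (2 : ℝ) ^ min (0 : ℤ) ⌊Real.logb 2 (Real.sqrt k / (ε * τ'))⌋ < 1 at h1
  change (2 : ℝ) ^ min (0 : ℤ) ⌊Real.logb 2 (Real.sqrt k / (ε * τ'))⌋
    ≤ (2 : ℝ) ^ min (0 : ℤ) ⌊Real.logb 2 (Real.sqrt k / (ε * τ))⌋ / 2
  have hlog : Real.logb 2 (Real.sqrt k / (ε * τ')) + 1 ≤ Real.logb 2 (Real.sqrt k / (ε * τ)) := by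
    have e : Real.logb 2 (Real.sqrt k / (ε * τ')) + 1
        = Real.logb 2 (Real.sqrt k / (ε * τ') * 2) := by
      rw [Real.logb_mul hpos'.ne' two_ne_zero, Real.logb_self_eq_one one_lt_two]
    rw [e]
    refine Real.logb_le_logb_of_le one_lt_two (by positivity) ?_
    rw [← div_div, ← div_div, div_mul_eq_mul_div, div_le_div_iff₀ hτ' hτ0]
    nlinarith
  have hfl : ⌊Real.logb 2 (Real.sqrt k / (ε * τ'))⌋ + 1
      ≤ ⌊Real.logb 2 (Real.sqrt k / (ε * τ))⌋ := by
    rw [← Int.floor_add_one]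
    exact Int.floor_le_floor hlog
  have hneg : ⌊Real.logb 2 (Real.sqrt k / (ε * τ'))⌋ < 0 := by
    by_contra hc
    rw [min_eq_left (not_lt.1 hc), zpow_zero] at h1
    exact lt_irrefl _ h1
  rw [min_eq_right hneg.le, le_div_iff₀ two_pos, ← zpow_add_one₀ two_ne_zero]
  exact zpow_le_zpow_right₀ one_le_two (le_min (by omega) hfl)

theorem transmitProb_anti (hR : 0 < Real.sqrt k / ε) {τ τ' : ℕ} (hτ : 0 < τ) (h : τ ≤ τ') :
    (transmitProb k ε τ' : ℝ) ≤ transmitProb k ε τ := by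
  have hτ0 : (0 : ℝ) < τ := by exact_mod_cast hτ
  have hτ1 : (τ : ℝ) ≤ τ' := by exact_mod_cast h
  have hτ' : (0 : ℝ) < τ' := by linarith
  apply zpow_le_zpow_right₀ one_le_two
  apply min_le_min le_rfl
  apply Int.floor_le_floor
  rw [← div_div, ← div_div]
  exact Real.logb_le_logb_of_le one_lt_two (by positivity) (by gcongr)

theorem transmitProb_one (hR : 1 ≤ Real.sqrt k / ε) :
    transmitProb k ε 1 = ⟨1, one_pos, le_rfl⟩ := by
  apply Subtype.ext
  change (2 : ℝ) ^ min (0 : ℤ) ⌊Real.logb 2 (Real.sqrt k / (ε * (1 : ℕ)))⌋ = 1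
  have : 0 ≤ Real.logb 2 (Real.sqrt k / (ε * (1 : ℕ))) := by
    apply Real.logb_nonneg one_lt_two
    simpa using hR
  rw [min_eq_left (Int.floor_nonneg.2 this), zpow_zero]

theorem transmitProb_eq_one_of_not_lt {τ : ℕ} (h : ¬ (transmitProb k ε τ : ℝ) < 1) :
    (transmitProb k ε τ : ℝ) = 1 :=
  le_antisymm (transmitProb k ε τ).2.2 (not_lt.1 h)

end TransmitProb

/-! ### The reaction of the protocol to one event -/

namespace State

variable {k : ℕ}

open Classical in
/-- The second half of the reaction to an event at site `i`: the doubling notification, if there is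
one, and the new round, if it starts one. -/
def settle (ε : ℝ) (s : State k) (i : Fin k) : PMF (State k) :=
  if ∃ j : ℕ, s.n i = 2 ^ j then
    if 2 * (s.doublingNotify i).threshold ≤ (s.doublingNotify i).approx then
      newRound ε (s.doublingNotify i) else PMF.pure (s.doublingNotify i)
  else PMF.pure s

theorem expect_event (ε : ℝ) (s : State k) (i : Fin k) (f : State k → ℝ≥0∞) :
    expect (s.event ε i) f
      = ENNReal.ofReal s.p * expect (((s.countEvent i).report i).settle ε i) f
        + ENNReal.ofReal (1 - (s.p : ℝ)) * expect ((s.countEvent i).settle ε i) f := by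
  unfold event
  rw [expect_bind, expect_coin]
  rfl

theorem mem_support_event {ε : ℝ} {s : State k} {i : Fin k} {s' : State k}
    (h : s' ∈ (s.event ε i).support) :
    s' ∈ (((s.countEvent i).report i).settle ε i).support
      ∨ s' ∈ ((s.countEvent i).settle ε i).support := by
  unfold event at h
  rw [PMF.mem_support_bind_iff] at h
  obtain ⟨X, -, hX⟩ := h
  cases X
  · exact Or.inr hX
  · exact Or.inl hX

/-- The number of events so far. -/
def total (s : State k) : ℕ := ∑ j, s.n j

/-- The last notified count `m` of a site with count `c` is the largest power of two up to `c`. -/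
def IsNotified (m c : ℕ) : Prop :=
  (m = 0 ∧ c = 0) ∨ ∃ a, m = 2 ^ a ∧ 2 ^ a ≤ c ∧ c < 2 ^ (a + 1)

theorem IsNotified.le_two_mul {m c : ℕ} (h : IsNotified m c) : c ≤ 2 * m := by
  rcases h with ⟨rfl, rfl⟩ | ⟨a, rfl, -, h⟩
  · exact le_rfl
  · rw [pow_succ] at h; omega

theorem IsNotified.of_eq_pow {c : ℕ} (h : ∃ j : ℕ, c = 2 ^ j) : IsNotified c c := by
  obtain ⟨j, rfl⟩ := h
  exact Or.inr ⟨j, rfl, le_rfl, Nat.pow_lt_pow_right one_lt_two (Nat.lt_succ_self j)⟩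

theorem IsNotified.succ {m c : ℕ} (h : IsNotified m c) (hc : ¬ ∃ j : ℕ, c + 1 = 2 ^ j) :
    IsNotified m (c + 1) := by
  rcases h with ⟨rfl, rfl⟩ | ⟨a, rfl, h1, h2⟩
  · exact (hc ⟨0, rfl⟩).elim
  · exact Or.inr ⟨a, rfl, h1.trans (Nat.le_succ c),
      lt_of_le_of_ne h2 fun h => hc ⟨a + 1, h⟩⟩

/-- The part of the invariant of the protocol that also holds in the middle of the reaction to an
event. -/
structure Consistent (ε : ℝ) (s : State k) : Prop where
  nbar_le : ∀ j, s.nbar j ≤ s.n j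
  nhat_eq : ∀ j, s.nhat j = siteEstimate s.p (s.nbar j)
  approx_eq : s.approx = ∑ j, s.notified j
  notified_le : ∀ j, s.notified j ≤ s.n j
  threshold_pos : 0 < s.threshold
  approx_lt : s.approx < 2 * s.threshold
  threshold_le : s.threshold ≤ max 1 s.total
  p_eq : s.p = transmitProb k ε s.threshold
  published_nonneg : 0 ≤ s.published

/-- The invariant of the protocol: the estimates are those computed from the last reports, and the
threshold of the doubling protocol is up to date. -/
structure Valid (ε : ℝ) (s : State k) : Prop extends Consistent ε s where
  isNotified : ∀ j, IsNotified (s.notified j) (s.n j)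

theorem valid_init {ε : ℝ} (hR : 1 ≤ Real.sqrt k / ε) : Valid ε (init k) where
  nbar_le _ := le_rfl
  nhat_eq _ := by simp [init, siteEstimate_zero]
  approx_eq := by simp [init]
  notified_le _ := le_rfl
  threshold_pos := one_pos
  approx_lt := by simp [init]
  threshold_le := le_max_left _ _
  p_eq := (transmitProb_one hR).symm
  published_nonneg := le_rfl
  isNotified _ := Or.inl ⟨rfl, rfl⟩

section Bounds

variable {ε : ℝ} {s : State k}

theorem Consistent.nhat_nonneg (h : Consistent ε s) (j : Fin k) : 0 ≤ s.nhat j := by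
  rw [h.nhat_eq]; exact siteEstimate_nonneg s.p.2.1 _

theorem Consistent.sumEstimate_nonneg (h : Consistent ε s) : 0 ≤ s.sumEstimate :=
  Finset.sum_nonneg fun j _ => h.nhat_nonneg j

theorem Consistent.nhat_sub_le (h : Consistent ε s) (j : Fin k) :
    s.nhat j - s.n j ≤ 1 / s.p - 1 := by
  rw [h.nhat_eq]
  have h1 := siteEstimate_le s.p.2.1 s.p.2.2 (s.nbar j)
  have h2 : (s.nbar j : ℝ) ≤ s.n j := by exact_mod_cast h.nbar_le j
  linarith

theorem Valid.total_lt (h : Valid ε s) : s.total < 4 * s.threshold := by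
  have h1 : s.total ≤ 2 * s.approx := by
    rw [h.approx_eq, Finset.mul_sum]
    exact Finset.sum_le_sum fun j _ => (h.isNotified j).le_two_mul
  have := h.approx_lt
  omega

theorem Consistent.le_p (h : Consistent ε s) (hR : 0 < Real.sqrt k / ε) {N : ℕ}
    (hN1 : 1 ≤ N) (hN : Real.sqrt k / ε ≤ 2 * N) (hs : s.total ≤ N) :
    Real.sqrt k / ε / (2 * N) ≤ s.p := by
  rw [h.p_eq]
  exact le_transmitProb hR h.threshold_pos (h.threshold_le.trans (max_le hN1 hs)) hN

theorem Valid.p_le (h : Valid ε s) (hR : 0 < Real.sqrt k / ε) {N : ℕ} (hN0 : 0 < N)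
    (hN : N ≤ 2 * s.total) : (s.p : ℝ) ≤ 8 * (Real.sqrt k / ε) / N := by
  rw [h.p_eq]
  refine (transmitProb_le hR h.threshold_pos).trans ?_
  have hτ : (0 : ℝ) < s.threshold := by exact_mod_cast h.threshold_pos
  have hN' : (0 : ℝ) < N := by exact_mod_cast hN0
  have h1 : N ≤ 8 * s.threshold := by have := h.total_lt; omega
  have h2 : (N : ℝ) ≤ 8 * s.threshold := by exact_mod_cast h1
  rw [div_le_div_iff₀ hτ hN']
  nlinarith

end Bounds

/-! ### Local effects of the protocol steps -/

theorem total_countEvent (s : State k) (i : Fin k) : (s.countEvent i).total = s.total + 1 := by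
  unfold total countEvent
  simp only
  rw [Finset.sum_update_of_mem (Finset.mem_univ i),
    ← Finset.add_sum_erase _ _ (Finset.mem_univ i), Finset.sdiff_singleton_eq_erase]
  omega

theorem Consistent.countEvent {ε : ℝ} {s : State k} (h : Consistent ε s) (i : Fin k) :
    Consistent ε (s.countEvent i) where
  nbar_le j := by
    refine (h.nbar_le j).trans ?_
    by_cases hj : j = i
    · subst hj; simp [State.countEvent]
    · simp [State.countEvent, hj]
  nhat_eq := h.nhat_eq
  approx_eq := h.approx_eq
  notified_le j := by
    refine (h.notified_le j).trans ?_
    by_cases hj : j = i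
    · subst hj; simp [State.countEvent]
    · simp [State.countEvent, hj]
  threshold_pos := h.threshold_pos
  approx_lt := h.approx_lt
  threshold_le := by
    rw [total_countEvent]
    exact h.threshold_le.trans (max_le_max le_rfl (Nat.le_succ _))
  p_eq := h.p_eq
  published_nonneg := h.published_nonneg

theorem published_report (s : State k) (i : Fin k) :
    (s.report i).published = (s.report i).sumEstimate := rfl

theorem nhat_report_self (s : State k) (i : Fin k) :
    (s.report i).nhat i = s.n i - 1 + 1 / s.p := by simp [report]

theorem nhat_report_of_ne (s : State k) {i j : Fin k} (h : j ≠ i) :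
    (s.report i).nhat j = s.nhat j := by simp [report, h]

theorem Consistent.report {ε : ℝ} {s : State k} (h : Consistent ε s) {i : Fin k}
    (hi : 0 < s.n i) : Consistent ε (s.report i) := by
  have hn : ∀ j, (s.report i).nhat j = siteEstimate s.p ((s.report i).nbar j) := by
    intro j
    by_cases hj : j = i
    · subst hj
      rw [nhat_report_self]
      simp [State.report, siteEstimate, hi.ne']
    · rw [nhat_report_of_ne s hj, h.nhat_eq]
      simp [State.report, hj]
  refine ⟨fun j => ?_, hn, h.approx_eq, h.notified_le, h.threshold_pos, h.approx_lt,
    h.threshold_le, h.p_eq, ?_⟩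
  · by_cases hj : j = i
    · subst hj; simp [State.report]
    · simpa [State.report, hj] using h.nbar_le j
  · rw [published_report]
    exact Finset.sum_nonneg fun j _ => by rw [hn]; exact siteEstimate_nonneg s.p.2.1 _

/-- Adjusting the sites of a list leaves everything but their last reports and estimates. -/
theorem of_mem_support_adjustAll (pold : TransmitProb) (l : List (Fin k)) :
    ∀ (s s' : State k), (∀ j ∉ l, s.nhat j = siteEstimate s.p (s.nbar j)) →
      s' ∈ (adjustAll pold l s).support →
      s'.n = s.n ∧ s'.notified = s.notified ∧ s'.approx = s.approx ∧ s'.threshold = s.threshold ∧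
        s'.p = s.p ∧ s'.published = s.published ∧ (∀ j, s'.nbar j ≤ s.nbar j) ∧
        ∀ j, s'.nhat j = siteEstimate s.p (s'.nbar j) := by
  induction l with
  | nil =>
    intro s s' h hs
    rw [adjustAll, PMF.support_pure, Set.mem_singleton_iff] at hs
    subst hs
    exact ⟨rfl, rfl, rfl, rfl, rfl, rfl, fun j => le_rfl, fun j => h j List.not_mem_nil⟩
  | cons i l ih =>
    intro s s' h hs
    rw [adjustAll, PMF.mem_support_bind_iff] at hs
    obtain ⟨Z, -, hZ⟩ := hs
    have := ih (s.adjust i Z) s' (fun j hj => ?_) hZ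
    · obtain ⟨h1, h2, h3, h4, h5, h6, h7, h8⟩ := this
      refine ⟨h1, h2, h3, h4, h5, h6, fun j => (h7 j).trans ?_, h8⟩
      by_cases hji : j = i
      · subst hji; simp [adjust]
      · simp [adjust, hji]
    · by_cases hji : j = i
      · subst hji; simp [adjust, siteEstimate]
      · simpa [adjust, hji] using h j (by simp [hji, hj])

/-- With the probability that no sampled shift is positive, the adjustment keeps all last
reports. -/
theorem exists_le_adjustAll (pold : TransmitProb) (l : List (Fin k)) :
    ∀ s : State k, (s.p : ℝ) ≤ pold → ∃ s' : State k,
      ENNReal.ofReal (((s.p : ℝ) / pold) ^ l.length) ≤ adjustAll pold l s s' ∧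
        s'.nbar = s.nbar := by
  induction l with
  | nil =>
    intro s _
    exact ⟨s, by simp [adjustAll], rfl⟩
  | cons i l ih =>
    intro s hp
    obtain ⟨s', h1, h2⟩ := ih (s.adjust i 0) hp
    refine ⟨s', ?_, ?_⟩
    · rw [adjustAll, PMF.bind_apply]
      refine le_trans ?_ (ENNReal.le_tsum 0)
      rw [List.length_cons, pow_succ', ENNReal.ofReal_mul (div_nonneg s.p.2.1.le pold.2.1.le)]
      exact mul_le_mul' (ofReal_le_zeroInflatedGeom_zero _ _ hp) h1
    · rw [h2]
      simp [adjust]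

/-- What is kept when the protocol settles from `s` to `s'` after an event: the server's total
estimate changes in a new round only if the transmission probability is at least halved. -/
structure Settled (ε : ℝ) (s s' : State k) : Prop where
  valid : Valid ε s'
  n_eq : s'.n = s.n
  published_eq : s'.published = s.published
  p_le : (s'.p = s.p ∧ s'.sumEstimate = s.sumEstimate) ∨ (s'.p : ℝ) ≤ s.p / 2

theorem Settled.p_le_p {ε : ℝ} {s s' : State k} (h : Settled ε s s') : (s'.p : ℝ) ≤ s.p := by
  rcases h.p_le with h | h
  · rw [h.1]
  · have := s.p.2.1; linarith

theorem Settled.total_eq {ε : ℝ} {s s' : State k} (h : Settled ε s s') : s'.total = s.total := by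
  unfold total; rw [h.n_eq]

/-- Right after an event at site `i`, the last notified counts are up to date, except for a
notification that site `i` has to send now. -/
def Pending (s : State k) (i : Fin k) : Prop :=
  0 < s.n i ∧ (∀ j, j ≠ i → IsNotified (s.notified j) (s.n j)) ∧
    ((¬ ∃ a : ℕ, s.n i = 2 ^ a) → IsNotified (s.notified i) (s.n i))

theorem Consistent.doublingNotify {ε : ℝ} {s : State k} (h : Consistent ε s) (i : Fin k) :
    (s.doublingNotify i).approx = ∑ j, (s.doublingNotify i).notified j ∧
      (∀ j, (s.doublingNotify i).notified j ≤ s.n j) := by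
  constructor
  · change s.approx + (s.n i - s.notified i) = ∑ j, Function.update s.notified i (s.n i) j
    rw [Finset.sum_update_of_mem (Finset.mem_univ i), h.approx_eq,
      ← Finset.add_sum_erase _ _ (Finset.mem_univ i), Finset.sdiff_singleton_eq_erase]
    have := h.notified_le i
    omega
  · intro j
    by_cases hj : j = i
    · subst hj; simp [State.doublingNotify]
    · simpa [State.doublingNotify, hj] using h.notified_le j

theorem isNotified_doublingNotify {s : State k} {i : Fin k} (hp : Pending s i)
    (hi : ∃ a : ℕ, s.n i = 2 ^ a) (j : Fin k) :
    IsNotified ((s.doublingNotify i).notified j) (s.n j) := by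
  by_cases hj : j = i
  · subst hj; simpa [State.doublingNotify] using IsNotified.of_eq_pow hi
  · simpa [State.doublingNotify, hj] using hp.2.1 j hj

theorem settled_of_mem_support {ε : ℝ} (hR : 0 < Real.sqrt k / ε) {s : State k} {i : Fin k}
    (h : Consistent ε s) (hp : Pending s i) {s' : State k}
    (hs : s' ∈ (s.settle ε i).support) : Settled ε s s' := by
  unfold settle at hs
  split_ifs at hs with h1 h2
  · obtain ⟨ha, hb⟩ := h.doublingNotify i
    have hN := isNotified_doublingNotify hp h1
    have hle : (s.doublingNotify i).approx ≤ s.total := by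
      rw [ha]; exact Finset.sum_le_sum fun j _ => hb j
    have hpos : 0 < (s.doublingNotify i).approx := by
      have : 0 < (s.doublingNotify i).threshold := h.threshold_pos
      omega
    unfold newRound at hs
    simp only at hs
    have hhalf := transmitProb_le_half hR (τ := s.threshold) (τ' := (s.doublingNotify i).approx)
      h.threshold_pos h2
    split_ifs at hs with h3
    · obtain ⟨e1, e2, e3, e4, e5, e6, e7, e8⟩ := of_mem_support_adjustAll _ _ _ _
        (fun j hj => (hj (List.mem_finRange j)).elim) hs
      simp only at e1 e2 e3 e4 e5 e6 e7 e8
      refine ⟨⟨⟨fun j => ?_, ?_, ?_, ?_, ?_, ?_, ?_, ?_, ?_⟩, ?_⟩, e1, e6, ?_⟩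
      · rw [e1]; exact (e7 j).trans (h.nbar_le j)
      · rw [e5]; exact e8
      · rw [e2, e3]; exact ha
      · rw [e2, e1]; exact hb
      · rw [e4]; exact hpos
      · rw [e3, e4]; omega
      · unfold total; rw [e4, e1]; exact hle.trans (le_max_right _ _)
      · rw [e5, e4]
      · rw [e6]; exact h.published_nonneg
      · rw [e1, e2]; exact hN
      · right
        rw [e5, h.p_eq]
        exact hhalf h3
    · rw [PMF.support_pure, Set.mem_singleton_iff] at hs
      have h4 := transmitProb_eq_one_of_not_lt h3
      have hold : (s.p : ℝ) = 1 := by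
        refine le_antisymm s.p.2.2 (h4.symm.le.trans ?_)
        rw [h.p_eq]
        refine transmitProb_anti hR h.threshold_pos ?_
        have h2' : 2 * s.threshold ≤ (s.doublingNotify i).approx := h2
        omega
      have hpp : s'.p = s.p := by
        rw [hs]; exact Subtype.ext (h4.trans hold.symm)
      refine ⟨⟨⟨?_, ?_, ?_, ?_, ?_, ?_, ?_, ?_, ?_⟩, ?_⟩, ?_, ?_, ?_⟩
      · rw [hs]; exact h.nbar_le
      · rw [hpp, hs]; exact h.nhat_eq
      · rw [hs]; exact ha
      · rw [hs]; exact hb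
      · rw [hs]; exact hpos
      · rw [hs]; change (s.doublingNotify i).approx < 2 * (s.doublingNotify i).approx; omega
      · rw [hs]; exact hle.trans (le_max_right _ _)
      · rw [hs]
      · rw [hs]; exact h.published_nonneg
      · rw [hs]; exact hN
      · rw [hs]; rfl
      · rw [hs]; rfl
      · left; exact ⟨hpp, by rw [hs]; rfl⟩
  · rw [PMF.support_pure, Set.mem_singleton_iff] at hs
    subst hs
    obtain ⟨ha, hb⟩ := h.doublingNotify i
    exact ⟨⟨⟨h.nbar_le, h.nhat_eq, ha, hb, h.threshold_pos, not_le.1 h2, h.threshold_le, h.p_eq,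
      h.published_nonneg⟩, isNotified_doublingNotify hp h1⟩, rfl, rfl, Or.inl ⟨rfl, rfl⟩⟩
  · rw [PMF.support_pure, Set.mem_singleton_iff] at hs
    subst hs
    refine ⟨⟨h, fun j => ?_⟩, rfl, rfl, Or.inl ⟨rfl, rfl⟩⟩
    by_cases hj : j = i
    · subst hj; exact hp.2.2 h1
    · exact hp.2.1 j hj

theorem Valid.pending_countEvent {ε : ℝ} {s : State k} (h : Valid ε s) (i : Fin k) :
    Pending (s.countEvent i) i := by
  have hi : (s.countEvent i).n i = s.n i + 1 := by simp [State.countEvent]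
  refine ⟨by omega, fun j hj => ?_, fun hc => ?_⟩
  · have : (s.countEvent i).n j = s.n j := by simp [State.countEvent, hj]
    rw [this]; exact h.isNotified j
  · rw [hi] at hc ⊢
    exact (h.isNotified i).succ hc

theorem Valid.pending_report {ε : ℝ} {s : State k} (h : Valid ε s) (i : Fin k) :
    Pending ((s.countEvent i).report i) i := h.pending_countEvent i

theorem Valid.consistent_countEvent {ε : ℝ} {s : State k} (h : Valid ε s) (i : Fin k) :
    Consistent ε (s.countEvent i) := h.toConsistent.countEvent i

theorem Valid.consistent_report {ε : ℝ} {s : State k} (h : Valid ε s) (i : Fin k) :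
    Consistent ε ((s.countEvent i).report i) :=
  (h.consistent_countEvent i).report (h.pending_countEvent i).1

/-- With probability at least `(p' / p) ^ k`, where `p` and `p'` are the transmission probabilities
before and after, no last report is moved back. -/
theorem exists_le_settle {ε : ℝ} (hR : 0 < Real.sqrt k / ε) {s : State k} {i : Fin k}
    (h : Consistent ε s) (hp : Pending s i) :
    ∃ s' : State k, ENNReal.ofReal (((s'.p : ℝ) / s.p) ^ k) ≤ s.settle ε i s' ∧
      s'.nbar = s.nbar ∧ Settled ε s s' := by
  have key : ∃ s' : State k, ENNReal.ofReal (((s'.p : ℝ) / s.p) ^ k) ≤ s.settle ε i s' ∧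
      s'.nbar = s.nbar := by
    have hone : ((s.p : ℝ) / s.p) ^ k = 1 := by rw [div_self s.p.2.1.ne', one_pow]
    unfold settle
    split_ifs with h1 h2
    · unfold newRound
      simp only
      split_ifs with h3
      · have hhalf := transmitProb_le_half hR (τ := s.threshold)
          (τ' := (s.doublingNotify i).approx) h.threshold_pos h2 h3
        rw [← h.p_eq] at hhalf
        have hpp := s.p.2.1
        obtain ⟨s', ha, hb⟩ := exists_le_adjustAll (s.doublingNotify i).p (List.finRange k)
          { s.doublingNotify i with
            threshold := (s.doublingNotify i).approx
            p := transmitProb k ε (s.doublingNotify i).approx } (by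
              change (transmitProb k ε (s.doublingNotify i).approx : ℝ) ≤ s.p
              linarith)
        refine ⟨s', ?_, hb⟩
        have hmem : s' ∈ (adjustAll (s.doublingNotify i).p (List.finRange k)
          { s.doublingNotify i with
            threshold := (s.doublingNotify i).approx
            p := transmitProb k ε (s.doublingNotify i).approx }).support := by
          rw [PMF.mem_support_iff]
          refine (lt_of_lt_of_le ?_ ha).ne'
          rw [ENNReal.ofReal_pos]
          exact pow_pos (div_pos (transmitProb k ε _).2.1 s.p.2.1) _
        have e5 := (of_mem_support_adjustAll _ _ _ _
          (fun j hj => (hj (List.mem_finRange j)).elim) hmem).2.2.2.2.1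
        rw [e5]
        rw [List.length_finRange] at ha
        exact ha
      · have hold : (s.p : ℝ) = 1 := by
          refine le_antisymm s.p.2.2 ((transmitProb_eq_one_of_not_lt h3).symm.le.trans ?_)
          rw [h.p_eq]
          refine transmitProb_anti hR h.threshold_pos ?_
          have h2' : 2 * s.threshold ≤ (s.doublingNotify i).approx := h2
          omega
        refine ⟨{ s.doublingNotify i with
            threshold := (s.doublingNotify i).approx
            p := transmitProb k ε (s.doublingNotify i).approx }, ?_, rfl⟩
        rw [PMF.pure_apply, if_pos rfl, ← ENNReal.ofReal_one]
        apply ENNReal.ofReal_le_ofReal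
        rw [hold, div_one, transmitProb_eq_one_of_not_lt h3, one_pow]
    · exact ⟨s.doublingNotify i, by
        rw [PMF.pure_apply, if_pos rfl]; exact (ENNReal.ofReal_le_ofReal hone.le).trans (by simp),
        rfl⟩
    · exact ⟨s, by rw [PMF.pure_apply, if_pos rfl, hone]; simp, rfl⟩
  obtain ⟨s', h1, h2⟩ := key
  refine ⟨s', h1, h2, settled_of_mem_support hR h hp ?_⟩
  rw [PMF.mem_support_iff]
  refine (lt_of_lt_of_le ?_ h1).ne'
  rw [ENNReal.ofReal_pos]
  exact pow_pos (div_pos s'.p.2.1 s.p.2.1) _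

end State

/-! ### The attack with a counter of its moves -/

section Attack

variable {k : ℕ} [NeZero k]

/-- The site to which the attack has moved after `c` moves. -/
def siteAt (k : ℕ) [NeZero k] (c : ℕ) : Fin k := Fin.ofNat k c

theorem siteAt_succ (c : ℕ) : siteAt k (c + 1) = siteAt k c + 1 := by
  apply Fin.ext
  simp [siteAt, Fin.val_add]

theorem siteAt_ne {c c' : ℕ} (h : c < c') (h' : c' < c + k) : siteAt k c ≠ siteAt k c' := by
  intro he
  have h1 : c % k = c' % k := congrArg Fin.val he
  have h2 : k ∣ c' - c := (Nat.modEq_iff_dvd' h.le).1 h1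
  have := Nat.le_of_dvd (by omega) h2
  omega

/-- The memory of the counting attack after the published estimate `est` has been observed. -/
def move (m : ℕ × ℝ) (est : ℝ) : ℕ × ℝ := if est = m.2 then m else (m.1 + 1, est)

theorem le_fst_move (m : ℕ × ℝ) (est : ℝ) : m.1 ≤ (move m est).1 := by
  unfold move; split_ifs <;> simp

theorem fst_move_le (m : ℕ × ℝ) (est : ℝ) : (move m est).1 ≤ m.1 + 1 := by
  unfold move; split_ifs <;> simp

theorem snd_move (m : ℕ × ℝ) (est : ℝ) : (move m est).2 = est := by
  unfold move; split_ifs with h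
  · exact h.symm
  · rfl

theorem move_self (m : ℕ × ℝ) : move m m.2 = m := by simp [move]

theorem move_of_ne {m : ℕ × ℝ} {est : ℝ} (h : est ≠ m.2) : (move m est).1 = m.1 + 1 := by
  simp [move, h]

/-- One event of the run against the counting attack. -/
def step (ε : ℝ) (x : State k × (ℕ × ℝ)) : PMF (State k × (ℕ × ℝ)) :=
  (x.1.event ε (siteAt k x.2.1)).map fun s => (s, move x.2 s.published)

/-- The given number of events of the run against the counting attack. -/
def stepN (ε : ℝ) : ℕ → State k × (ℕ × ℝ) → PMF (State k × (ℕ × ℝ))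
  | 0, x => PMF.pure x
  | m + 1, x => (step ε x).bind (stepN ε m)

/-- The run against the round-robin attack with a memory that counts the moves of the attack,
instead of only keeping the current site, which is the number of moves modulo `k`. -/
def countedRun (k : ℕ) [NeZero k] (ε : ℝ) : ℕ → PMF (State k × (ℕ × ℝ))
  | 0 => PMF.pure (State.init k, (0, 0))
  | n + 1 => (countedRun k ε n).bind (step ε)

theorem countedRun_succ (ε : ℝ) (n : ℕ) :
    countedRun k ε (n + 1) = (countedRun k ε n).bind (step ε) := rfl

theorem countedRun_add (ε : ℝ) (m : ℕ) :
    ∀ n, countedRun k ε (n + m) = (countedRun k ε n).bind (stepN ε m) := by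
  induction m with
  | zero => intro n; exact (PMF.bind_pure _).symm
  | succ m ih =>
    intro n
    rw [← Nat.add_assoc, Nat.add_right_comm, ih, countedRun_succ, PMF.bind_bind]
    rfl

theorem run_roundRobinAttack (ε : ℝ) (n : ℕ) :
    run ε (roundRobinAttack k) n
      = (countedRun k ε n).map fun x => (x.1, (siteAt k x.2.1, x.2.2)) := by
  induction n with
  | zero =>
    exact (PMF.pure_map (fun x : State k × (ℕ × ℝ) => (x.1, (siteAt k x.2.1, x.2.2)))
      (State.init k, (0, 0))).symm
  | succ n ih =>
    have h1 : run ε (roundRobinAttack k) (n + 1)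
        = ((countedRun k ε n).map fun x => (x.1, (siteAt k x.2.1, x.2.2))).bind
          fun x : State k × (Fin k × ℝ) => (x.1.event ε x.2.1).map
            fun s => (s, if s.published = x.2.2 then x.2 else (x.2.1 + 1, s.published)) := by
      rw [← ih]; rfl
    rw [h1, countedRun_succ, PMF.map_bind, PMF.bind_map]
    congr 1
    funext x
    simp only [Function.comp_apply, step, PMF.map_comp]
    congr 1
    funext s
    simp only [Function.comp_apply, move]
    split_ifs
    · rfl
    · simp only [siteAt_succ]

/-- The published estimate is the one recorded by the attack, and the state is valid. -/
structure Synced (ε : ℝ) (x : State k × (ℕ × ℝ)) : Prop where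
  valid : x.1.Valid ε
  snd_eq : x.2.2 = x.1.published

/-- The state right after the current site has received an event and has not reported it. -/
abbrev silent (x : State k × (ℕ × ℝ)) : State k := x.1.countEvent (siteAt k x.2.1)

/-- The state right after the current site has received and reported an event. -/
abbrev reported (x : State k × (ℕ × ℝ)) : State k :=
  (x.1.countEvent (siteAt k x.2.1)).report (siteAt k x.2.1)

theorem Synced.of_mem_support {ε : ℝ} (hR : 0 < Real.sqrt k / ε) {x x' : State k × (ℕ × ℝ)}
    (h : Synced ε x) (hx : x' ∈ (step ε x).support) :
    Synced ε x' ∧ ((State.Settled ε (reported x) x'.1 ∧ x'.2 = move x.2 (reported x).published) ∨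
      (State.Settled ε (silent x) x'.1 ∧ x'.2 = x.2)) := by
  unfold step at hx
  rw [PMF.mem_support_map_iff] at hx
  obtain ⟨s, hs, rfl⟩ := hx
  rcases State.mem_support_event hs with hs | hs
  · have hS := State.settled_of_mem_support hR (h.valid.consistent_report _)
      (h.valid.pending_report _) hs
    exact ⟨⟨hS.valid, snd_move _ _⟩, Or.inl ⟨hS, by simp only [hS.published_eq]⟩⟩
  · have hS := State.settled_of_mem_support hR (h.valid.consistent_countEvent _)
      (h.valid.pending_countEvent _) hs
    refine ⟨⟨hS.valid, snd_move _ _⟩, Or.inr ⟨hS, ?_⟩⟩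
    have : s.published = x.2.2 := by rw [hS.published_eq, h.snd_eq]; rfl
    simp only [this, move_self]

theorem total_silent (x : State k × (ℕ × ℝ)) : (silent x).total = x.1.total + 1 :=
  State.total_countEvent _ _

theorem total_reported (x : State k × (ℕ × ℝ)) : (reported x).total = x.1.total + 1 :=
  State.total_countEvent _ _

theorem Synced.total_of_mem_support {ε : ℝ} (hR : 0 < Real.sqrt k / ε)
    {x x' : State k × (ℕ × ℝ)} (h : Synced ε x) (hx : x' ∈ (step ε x).support) :
    x'.1.total = x.1.total + 1 := by
  rcases (h.of_mem_support hR hx).2 with hS | hS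
  · rw [hS.1.total_eq, total_reported]
  · rw [hS.1.total_eq, total_silent]

theorem synced_of_mem_support_countedRun {ε : ℝ} (hR : 1 ≤ Real.sqrt k / ε) (n : ℕ) :
    ∀ x ∈ (countedRun k ε n).support, Synced ε x ∧ x.1.total = n := by
  have hR0 : 0 < Real.sqrt k / ε := by linarith
  induction n with
  | zero =>
    intro x hx
    rw [countedRun, PMF.support_pure, Set.mem_singleton_iff] at hx
    subst hx
    exact ⟨⟨State.valid_init hR, rfl⟩, by simp [State.total, State.init]⟩
  | succ n ih =>
    intro x hx
    rw [countedRun_succ, PMF.mem_support_bind_iff] at hx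
    obtain ⟨y, hy, hyx⟩ := hx
    obtain ⟨h1, h2⟩ := ih y hy
    exact ⟨(h1.of_mem_support hR0 hyx).1, by rw [h1.total_of_mem_support hR0 hyx, h2]⟩

/-- The two outcomes of an event: it is reported, and the attack moves if this changes the published
estimate; or it is not, and the attack stays. -/
theorem expect_step {ε : ℝ} (hR : 0 < Real.sqrt k / ε) {x : State k × (ℕ × ℝ)}
    (h : Synced ε x) (f : State k × (ℕ × ℝ) → ℝ≥0∞) :
    expect (step ε x) f
      = ENNReal.ofReal x.1.p * expect ((reported x).settle ε (siteAt k x.2.1))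
          (fun s => f (s, move x.2 (reported x).published))
        + ENNReal.ofReal (1 - (x.1.p : ℝ)) * expect ((silent x).settle ε (siteAt k x.2.1))
          (fun s => f (s, x.2)) := by
  unfold step
  rw [expect_map, State.expect_event]
  congr 2
  · refine expect_congr fun s hs => ?_
    have hS := State.settled_of_mem_support hR (h.valid.consistent_report _)
      (h.valid.pending_report _) hs
    rw [hS.published_eq]
  · refine expect_congr fun s hs => ?_
    have hS := State.settled_of_mem_support hR (h.valid.consistent_countEvent _)
      (h.valid.pending_countEvent _) hs
    have : s.published = x.2.2 := by rw [hS.published_eq, h.snd_eq]; rfl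
    rw [this, move_self]

/-- Backward induction: a bound `V m x`, given `m` remaining events, on the expectation of `f` at
time `T`. -/
theorem expect_stepN_le {ε : ℝ} (hR : 0 < Real.sqrt k / ε) (T : ℕ)
    {V : ℕ → State k × (ℕ × ℝ) → ℝ≥0∞} {P : State k × (ℕ × ℝ) → Prop}
    {f : State k × (ℕ × ℝ) → ℝ≥0∞}
    (hP : ∀ x x' : State k × (ℕ × ℝ), Synced ε x → x' ∈ (step ε x).support → P x → P x')
    (h0 : ∀ x : State k × (ℕ × ℝ), Synced ε x → x.1.total = T → P x → f x ≤ V 0 x)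
    (hV : ∀ m, ∀ x : State k × (ℕ × ℝ), Synced ε x → x.1.total + (m + 1) = T → P x →
      expect (step ε x) (V m) ≤ V (m + 1) x)
    (m : ℕ) : ∀ x, Synced ε x → x.1.total + m = T → P x → expect (stepN ε m x) f ≤ V m x := by
  induction m with
  | zero =>
    intro x hx hT hPx
    rw [stepN, expect_pure]
    exact h0 x hx hT hPx
  | succ m ih =>
    intro x hx hT hPx
    rw [stepN, expect_bind]
    refine (expect_mono fun x' hx' => ?_).trans (hV m x hx hT hPx)
    refine ih x' (hx.of_mem_support hR hx').1 ?_ (hP x x' hx hx' hPx)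
    rw [hx.total_of_mem_support hR hx']
    omega

/-- Backward induction for a lower bound. -/
theorem le_expect_stepN {ε : ℝ} (hR : 0 < Real.sqrt k / ε) {T : ℕ}
    {V : ℕ → State k × (ℕ × ℝ) → ℝ≥0∞} {f : State k × (ℕ × ℝ) → ℝ≥0∞}
    (h0 : ∀ x : State k × (ℕ × ℝ), Synced ε x → x.1.total = T → V 0 x ≤ f x)
    (hV : ∀ m, ∀ x : State k × (ℕ × ℝ), Synced ε x → x.1.total + (m + 1) = T →
      V (m + 1) x ≤ expect (step ε x) (V m))
    (m : ℕ) : ∀ x, Synced ε x → x.1.total + m = T → V m x ≤ expect (stepN ε m x) f := by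
  induction m with
  | zero =>
    intro x hx hT
    rw [stepN, expect_pure]
    exact h0 x hx hT
  | succ m ih =>
    intro x hx hT
    rw [stepN, expect_bind]
    refine (hV m x hx hT).trans (expect_mono fun x' hx' => ?_)
    refine ih x' (hx.of_mem_support hR hx').1 ?_
    rw [hx.total_of_mem_support hR hx']
    omega

theorem synced_of_mem_support_stepN {ε : ℝ} (hR : 0 < Real.sqrt k / ε) (m : ℕ) :
    ∀ x : State k × (ℕ × ℝ), Synced ε x → ∀ x' ∈ (stepN ε m x).support,
      Synced ε x' ∧ x'.1.total = x.1.total + m := by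
  induction m with
  | zero =>
    intro x hx x' hx'
    rw [stepN, PMF.support_pure, Set.mem_singleton_iff] at hx'
    subst hx'
    exact ⟨hx, rfl⟩
  | succ m ih =>
    intro x hx x' hx'
    rw [stepN, PMF.mem_support_bind_iff] at hx'
    obtain ⟨y, hy, hyx⟩ := hx'
    obtain ⟨h1, h2⟩ := ih y (hx.of_mem_support hR hy).1 x' hyx
    exact ⟨h1, by rw [h2, hx.total_of_mem_support hR hy]; omega⟩

end Attack

/-! ### Exponential potentials -/

section Potential

variable {k : ℕ}

open Classical in
/-- The estimation error with which site `j` enters the potential: `g` for the sites in `F`, the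
error right after a report for the remaining sites in `A`, and the actual error otherwise. -/
def virtualError (A F : Set (Fin k)) (g : ℝ) (s : State k) (j : Fin k) : ℝ :=
  if j ∈ F then g else if j ∈ A then 1 / (s.p : ℝ) - 1 else s.nhat j - s.n j

/-- The discount that compensates for the second-order cost of all rounds up to the present one: as
the transmission probability `p` is at least halved from round to round, the costs, of order
`k * (l / p) ^ 2`, add up geometrically. -/
def discount (l : ℝ) (s : State k) : ℝ := 4 * k * (l / s.p) ^ 2

/-- The discounted exponential moment of the total error, with the errors of some sites
replaced. -/
def potential (l : ℝ) (A F : Set (Fin k)) (g : ℝ) (s : State k) : ℝ :=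
  Real.exp (-l * ∑ j, virtualError A F g s j - discount l s)

theorem potential_pos (l : ℝ) (A F : Set (Fin k)) (g : ℝ) (s : State k) :
    0 < potential l A F g s := Real.exp_pos _

theorem potential_le_of_virtualError_le {l : ℝ} (hl : 0 ≤ l) {A F A' F' : Set (Fin k)} {g : ℝ}
    {s s' : State k} (hp : s'.p = s.p)
    (h : ∀ j, virtualError A F g s j ≤ virtualError A' F' g s' j) :
    potential l A' F' g s' ≤ potential l A F g s := by
  unfold potential discount
  rw [hp]
  apply Real.exp_le_exp.2
  have := mul_le_mul_of_nonneg_left (Finset.sum_le_sum fun j (_ : j ∈ Finset.univ) => h j) hl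
  linarith

theorem potential_countEvent {l : ℝ} (hl : 0 ≤ l) {A F : Set (Fin k)} {g : ℝ} (s : State k)
    {i : Fin k} (hi : i ∈ A) : potential l A F g (s.countEvent i) ≤ potential l A F g s := by
  refine potential_le_of_virtualError_le hl rfl fun j => le_of_eq ?_
  unfold virtualError
  split_ifs with h1 h2
  · rfl
  · rfl
  · have : j ≠ i := fun h => h2 (h ▸ hi)
    simp [State.countEvent, this]

/-- A report at site `i` brings the error of this site to its largest possible value `1 / p - 1`, so
that the potential no longer has to replace this error. The sites that leave `F` at the same time
have to enter with an error of at least `g`. -/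
theorem potential_report_le {ε l : ℝ} (hl : 0 ≤ l) {A F F' : Set (Fin k)} {g : ℝ} {s : State k}
    (hs : s.Valid ε) {i : Fin k} (hF : F' ⊆ F) (hA : ∀ j ∈ F, j ∉ F' → j ∈ A)
    (hg : F = F' ∨ g ≤ 1 / s.p - 1) :
    potential l A F' g ((s.countEvent i).report i) ≤ potential l {i} F g s := by
  refine potential_le_of_virtualError_le hl rfl fun j => ?_
  unfold virtualError
  by_cases h1 : j ∈ F
  · by_cases h2 : j ∈ F'
    · simp [h1, h2]
    · rw [if_pos h1, if_neg h2, if_pos (hA j h1 h2)]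
      rcases hg with rfl | hg
      · exact (h2 h1).elim
      · exact hg
  · have h2 : j ∉ F' := fun h => h1 (hF h)
    rw [if_neg h1, if_neg h2]
    have hn : ((s.countEvent i).report i).p = s.p := rfl
    by_cases hji : j = i
    · subst hji
      rw [if_pos (Set.mem_singleton j)]
      split_ifs
      · exact le_rfl
      · rw [State.nhat_report_self]
        refine le_of_eq ?_
        change _ = ((s.countEvent j).n j : ℝ) - 1 + 1 / s.p - (s.countEvent j).n j
        ring
    · rw [if_neg (by simpa using hji)]
      split_ifs
      · exact hs.nhat_sub_le j
      · rw [State.nhat_report_of_ne _ hji]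
        simp [State.countEvent, State.report, hji]

theorem potential_empty (l g : ℝ) (s : State k) :
    potential l ∅ ∅ g s
      = Real.exp (-l * (s.sumEstimate - s.total) - discount l s) := by
  unfold potential virtualError State.sumEstimate State.total
  simp [Finset.sum_sub_distrib]

theorem virtualError_adjust_of_ne (A F : Set (Fin k)) (g : ℝ) (s : State k) {i j : Fin k} (Z : ℕ)
    (h : j ≠ i) : virtualError A F g (s.adjust i Z) j = virtualError A F g s j := by
  unfold virtualError
  simp [State.adjust, h]

/-- The sites with replaced errors are not affected, and the others are adjusted one by one. -/
theorem expect_adjustAll_exp_le {l : ℝ} (hl : 0 ≤ l) (A F : Set (Fin k)) (g : ℝ)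
    (pold : TransmitProb) (L : List (Fin k)) :
    ∀ s : State k, L.Nodup → (s.p : ℝ) ≤ pold → l ≤ s.p / 2 →
      (∀ j ∈ L, s.nhat j = siteEstimate pold (s.nbar j)) →
      (expect (State.adjustAll pold L s) fun s' =>
          ENNReal.ofReal (Real.exp (-l * ∑ j, virtualError A F g s' j)))
        ≤ ENNReal.ofReal (Real.exp (2 * (l / s.p) ^ 2 * L.length)
          * Real.exp (-l * ∑ j, virtualError A F g s j)) := by
  classical
  induction L with
  | nil =>
    intro s _ _ _ _
    rw [State.adjustAll, expect_pure]
    simp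
  | cons i L ih =>
    intro s hL hp hls hn
    rw [List.nodup_cons] at hL
    rw [State.adjustAll, expect_bind]
    refine (expect_mono fun Z _ => ih (s.adjust i Z) hL.2 hp hls fun j hj => ?_).trans ?_
    · have hji : j ≠ i := fun h => hL.1 (h ▸ hj)
      simpa [State.adjust, hji] using hn j (List.mem_cons_of_mem _ hj)
    · have hsplit : ∀ s' : State k, ∑ j, virtualError A F g s' j
          = virtualError A F g s' i + ∑ j ∈ Finset.univ.erase i, virtualError A F g s' j :=
        fun s' => (Finset.add_sum_erase _ _ (Finset.mem_univ i)).symm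
      have hrest : ∀ Z, ∑ j ∈ Finset.univ.erase i, virtualError A F g (s.adjust i Z) j
          = ∑ j ∈ Finset.univ.erase i, virtualError A F g s j := fun Z =>
        Finset.sum_congr rfl fun j hj =>
          virtualError_adjust_of_ne A F g s Z (Finset.ne_of_mem_erase hj)
      have hpadj : ∀ Z, (s.adjust i Z).p = s.p := fun Z => rfl
      set S := ∑ j ∈ Finset.univ.erase i, virtualError A F g s j with hS
      set C := Real.exp (2 * (l / s.p) ^ 2 * L.length) with hC
      have hone : (expect (zeroInflatedGeom s.p pold) fun Z =>
            ENNReal.ofReal (Real.exp (-l * virtualError A F g (s.adjust i Z) i)))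
          ≤ ENNReal.ofReal (Real.exp (2 * (l / s.p) ^ 2)
            * Real.exp (-l * virtualError A F g s i)) := by
        by_cases hi : i ∈ F ∨ i ∈ A
        · have : ∀ Z, virtualError A F g (s.adjust i Z) i = virtualError A F g s i := by
            intro Z
            unfold virtualError
            by_cases hF : i ∈ F
            · simp [hF]
            · rw [if_neg hF, if_neg hF, if_pos (hi.resolve_left hF),
                if_pos (hi.resolve_left hF)]
              rfl
          simp only [this, expect_const]
          apply ENNReal.ofReal_le_ofReal
          exact le_mul_of_one_le_left (Real.exp_pos _).le (Real.one_le_exp (by positivity))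
        · push Not at hi
          have h1 : ∀ Z, Real.exp (-l * virtualError A F g (s.adjust i Z) i)
              = Real.exp (l * s.n i) * Real.exp (-l * siteEstimate s.p (s.nbar i - Z)) := by
            intro Z
            unfold virtualError
            rw [if_neg hi.1, if_neg hi.2, ← Real.exp_add]
            congr 1
            have : (s.adjust i Z).nhat i = siteEstimate s.p (s.nbar i - Z) := by
              simp [State.adjust, siteEstimate]
            rw [this]
            change -l * (_ - (s.n i : ℝ)) = _
            ring
          have h2 : Real.exp (-l * virtualError A F g s i)
              = Real.exp (l * s.n i) * Real.exp (-l * siteEstimate pold (s.nbar i)) := by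
            unfold virtualError
            rw [if_neg hi.1, if_neg hi.2, ← Real.exp_add, hn i (by simp)]
            congr 1
            ring
          simp only [h1, h2, ENNReal.ofReal_mul (Real.exp_pos _).le, expect_const_mul]
          have h3 := expect_exp_adjust_le s.p pold hp hl hls (s.nbar i)
          rw [ENNReal.ofReal_mul (Real.exp_pos _).le] at h3
          calc _ ≤ _ := mul_le_mul_right h3 _
            _ = _ := by ring
      have hfac : ∀ Z, ENNReal.ofReal (Real.exp (2 * (l / ((s.adjust i Z).p : ℝ)) ^ 2 * L.length)
            * Real.exp (-l * ∑ j, virtualError A F g (s.adjust i Z) j))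
          = ENNReal.ofReal (C * Real.exp (-l * S))
            * ENNReal.ofReal (Real.exp (-l * virtualError A F g (s.adjust i Z) i)) := by
        intro Z
        rw [hsplit, hrest, ← ENNReal.ofReal_mul (by positivity), mul_add, Real.exp_add, hpadj]
        congr 1
        ring
      simp only [hfac, expect_const_mul]
      refine (mul_le_mul_right hone _).trans ?_
      rw [← ENNReal.ofReal_mul (by positivity)]
      apply ENNReal.ofReal_le_ofReal
      rw [hsplit s, ← hS, mul_add, Real.exp_add, List.length_cons, Nat.cast_add, Nat.cast_one,
        mul_add, mul_one, Real.exp_add]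
      exact le_of_eq (by ring)

/-- The potentials do not increase in expectation when the protocol settles after an event. -/
theorem expect_settle_potential_le {ε l : ℝ} (hR : 0 < Real.sqrt k / ε) (hl : 0 ≤ l) {N : ℕ}
    (hN : Real.sqrt k / ε ≤ 2 * N) (hlN : l ≤ Real.sqrt k / ε / (2 * N) / 2)
    (A F : Set (Fin k)) (g : ℝ) {s : State k} {i : Fin k} (hs : s.Consistent ε)
    (hsN : s.total ≤ N) :
    (expect (s.settle ε i) fun s' => ENNReal.ofReal (potential l A F g s'))
      ≤ ENNReal.ofReal (potential l A F g s) := by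
  unfold State.settle
  split_ifs with h1 h2
  · obtain ⟨ha, hb⟩ := hs.doublingNotify i
    have hle : (s.doublingNotify i).approx ≤ s.total := by
      rw [ha]; exact Finset.sum_le_sum fun j _ => hb j
    have h2' : 2 * s.threshold ≤ (s.doublingNotify i).approx := h2
    have hthr := hs.threshold_pos
    unfold State.newRound
    simp only
    set q := transmitProb k ε (s.doublingNotify i).approx with hq
    split_ifs with h3
    · have hhalf : (q : ℝ) ≤ s.p / 2 := by
        rw [hs.p_eq]
        exact transmitProb_le_half hR hthr h2' h3
      have hq0 := q.2.1
      have hp0 := s.p.2.1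
      have hlq : l ≤ q / 2 := hlN.trans (by
        have := le_transmitProb hR (τ := (s.doublingNotify i).approx) (by omega)
          (hle.trans hsN) hN
        linarith)
      set s₀ : State k := { s.doublingNotify i with
        threshold := (s.doublingNotify i).approx
        p := q } with hs₀
      have hadj := expect_adjustAll_exp_le hl A F g s.p (List.finRange k) s₀
        (List.nodup_finRange k) (by change (q : ℝ) ≤ s.p; linarith) hlq
        (fun j _ => hs.nhat_eq j)
      have hcongr : (expect (State.adjustAll (s.doublingNotify i).p (List.finRange k) s₀)
            fun s' => ENNReal.ofReal (potential l A F g s'))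
          = ENNReal.ofReal (Real.exp (-(4 * k * (l / q) ^ 2)))
            * expect (State.adjustAll s.p (List.finRange k) s₀)
              fun s' => ENNReal.ofReal (Real.exp (-l * ∑ j, virtualError A F g s' j)) := by
        rw [← expect_const_mul]
        refine expect_congr fun s' hs' => ?_
        have e5 := (State.of_mem_support_adjustAll _ _ _ _
          (fun j hj => (hj (List.mem_finRange j)).elim) hs').2.2.2.2.1
        rw [← ENNReal.ofReal_mul (Real.exp_pos _).le, ← Real.exp_add]
        unfold potential discount
        rw [e5]
        congr 2
        change _ - 4 * (k : ℝ) * (l / q) ^ 2 = _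
        ring
      rw [hcongr]
      refine (mul_le_mul_right hadj _).trans ?_
      rw [← ENNReal.ofReal_mul (Real.exp_pos _).le, ← Real.exp_add, ← Real.exp_add]
      apply ENNReal.ofReal_le_ofReal
      apply Real.exp_le_exp.2
      have hve : ∑ j, virtualError A F g s j ≤ ∑ j, virtualError A F g s₀ j := by
        refine Finset.sum_le_sum fun j _ => ?_
        unfold virtualError
        split_ifs
        · exact le_rfl
        · change 1 / (s.p : ℝ) - 1 ≤ 1 / (q : ℝ) - 1
          have : 1 / (s.p : ℝ) ≤ 1 / q := one_div_le_one_div_of_le hq0 (by linarith)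
          linarith
        · exact le_rfl
      have hve' := mul_le_mul_of_nonneg_left hve hl
      have hsq : 4 * (l / s.p) ^ 2 ≤ (l / q) ^ 2 := by
        have : 2 * (l / s.p) ≤ l / q := by
          rw [← mul_div_assoc, div_le_div_iff₀ hp0 hq0]
          nlinarith
        have h0 : 0 ≤ l / s.p := by positivity
        nlinarith
      have hk : (0 : ℝ) ≤ k := Nat.cast_nonneg k
      have hsq' := mul_le_mul_of_nonneg_left hsq hk
      have hsq0 : 0 ≤ (k : ℝ) * (l / s.p) ^ 2 := by positivity
      unfold discount
      rw [List.length_finRange]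
      change -(4 * (k : ℝ) * (l / q) ^ 2) + (2 * (l / q) ^ 2 * k + _) ≤ _
      linarith
    · have h4 := transmitProb_eq_one_of_not_lt h3
      have hold : (s.p : ℝ) = 1 := by
        refine le_antisymm s.p.2.2 (h4.symm.le.trans ?_)
        rw [hs.p_eq]
        exact transmitProb_anti hR hthr (by omega)
      have hqp : q = s.p := Subtype.ext (h4.trans hold.symm)
      rw [expect_pure, hqp]
      exact le_rfl
  · rw [expect_pure]
    exact le_rfl
  · rw [expect_pure]

end Potential

/-! ### The potentials along the run -/

section State

variable {k : ℕ}

open Classical in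
/-- An error `g` instead of `0` for the sites in `F` contributes a deterministic factor. -/
theorem potential_frozen (l : ℝ) (A F : Set (Fin k)) (g : ℝ) (s : State k) :
    potential l A F g s
      = Real.exp (-(l * g * (Finset.univ.filter (· ∈ F)).card)) * potential l A F 0 s := by
  have h : ∀ j, virtualError A F g s j
      = virtualError A F 0 s j + if j ∈ F then g else 0 := by
    intro j
    unfold virtualError
    split_ifs <;> simp
  unfold potential
  rw [← Real.exp_add, Finset.sum_congr rfl fun j _ => h j, Finset.sum_add_distrib,
    Finset.sum_ite, Finset.sum_const_zero, Finset.sum_const, nsmul_eq_mul]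
  congr 1
  ring

open Classical in
/-- The reports still to be expected, on an exponential scale: a report increases the number of
moves, unless it restores the published estimate to the sum of the estimates of the sites, and each
deviation of the latter is preceded by a halving of the transmission probability. -/
def moveWeight (s : State k) (c : ℕ) : ℝ :=
  s.p * (1 / 2) ^ c * if s.published = s.sumEstimate then 1 / 2 else 1

theorem moveWeight_settled {ε : ℝ} {s s' : State k} (h : State.Settled ε s s') (c : ℕ) :
    moveWeight s' c ≤ moveWeight s c := by
  unfold moveWeight
  have h0 : (0 : ℝ) ≤ (1 / 2) ^ c := by positivity
  have hp' := s'.p.2.1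
  rcases h.p_le with ⟨h1, h2⟩ | h1
  · rw [h1, h2, h.published_eq]
  · have : (s'.p : ℝ) * (1 / 2) ^ c * (if s'.published = s'.sumEstimate then 1 / 2 else 1)
        ≤ s'.p * (1 / 2) ^ c := by
      refine mul_le_of_le_one_right (by positivity) ?_
      split_ifs <;> norm_num
    refine this.trans ?_
    have h2 : (s.p : ℝ) * (1 / 2) ^ c * (1 / 2) ≤ s.p * (1 / 2) ^ c *
        (if s.published = s.sumEstimate then 1 / 2 else 1) := by
      refine mul_le_mul_of_nonneg_left ?_ (mul_nonneg s.p.2.1.le h0)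
      split_ifs <;> norm_num
    refine le_trans ?_ h2
    have := mul_le_mul_of_nonneg_right h1 h0
    linarith

theorem moveWeight_nonneg (s : State k) (c : ℕ) : 0 ≤ moveWeight s c := by
  unfold moveWeight
  have := s.p.2.1
  split_ifs <;> positivity

end State

section Run

variable {k : ℕ} [NeZero k] {ε : ℝ}

theorem ofReal_p_add (p : TransmitProb) (a : ℝ≥0∞) :
    ENNReal.ofReal p * a + ENNReal.ofReal (1 - (p : ℝ)) * a = a := by
  rw [← add_mul, ← ENNReal.ofReal_add p.2.1.le (sub_nonneg.2 p.2.2), add_sub_cancel,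
    ENNReal.ofReal_one, one_mul]

/-- The potential of the attack with the current site virtually at its largest possible error. The
sites in `F`, which may depend on the number of moves, enter with the error `g`; they may leave
`F` when the attack moves to them. -/
theorem expect_step_potential_le {l : ℝ} (hR : 0 < Real.sqrt k / ε) (hl : 0 ≤ l) {N : ℕ}
    (hN : Real.sqrt k / ε ≤ 2 * N) (hlN : l ≤ Real.sqrt k / ε / (2 * N) / 2)
    {F : ℕ → Set (Fin k)} {g : ℝ} {x : State k × (ℕ × ℝ)} (hx : Synced ε x)
    (hT : x.1.total + 1 ≤ N) (hF : F (x.2.1 + 1) ⊆ F x.2.1)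
    (hA : ∀ j ∈ F x.2.1, j ∉ F (x.2.1 + 1) → j = siteAt k (x.2.1 + 1))
    (hg : F x.2.1 = F (x.2.1 + 1) ∨ g ≤ 1 / x.1.p - 1) :
    (expect (step ε x) fun y =>
        ENNReal.ofReal (potential l {siteAt k y.2.1} (F y.2.1) g y.1))
      ≤ ENNReal.ofReal (potential l {siteAt k x.2.1} (F x.2.1) g x.1) := by
  have hT' : (reported x).total ≤ N := by rw [total_reported]; exact hT
  have hF' : (silent x).total ≤ N := by rw [total_silent]; exact hT
  have h1 := (expect_settle_potential_le (i := siteAt k x.2.1) hR hl hN hlN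
    {siteAt k (move x.2 (reported x).published).1} (F (move x.2 (reported x).published).1) g
    (hx.valid.consistent_report _) hT')
  have h2 := (expect_settle_potential_le (i := siteAt k x.2.1) hR hl hN hlN
    {siteAt k x.2.1} (F x.2.1) g (hx.valid.consistent_countEvent _) hF')
  have h3 : potential l {siteAt k (move x.2 (reported x).published).1}
      (F (move x.2 (reported x).published).1) g (reported x)
      ≤ potential l {siteAt k x.2.1} (F x.2.1) g x.1 := by
    by_cases hm : (reported x).published = x.2.2
    · have : move x.2 (reported x).published = x.2 := by rw [hm, move_self]
      rw [this]
      exact potential_report_le hl hx.valid le_rfl (fun j h1 h2 => (h2 h1).elim) (Or.inl rfl)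
    · rw [move_of_ne hm]
      exact potential_report_le hl hx.valid hF hA hg
  have h4 : potential l {siteAt k x.2.1} (F x.2.1) g (silent x)
      ≤ potential l {siteAt k x.2.1} (F x.2.1) g x.1 :=
    potential_countEvent hl _ (Set.mem_singleton _)
  rw [expect_step hR hx]
  exact le_of_le_of_eq (add_le_add
    (mul_le_mul_right (h1.trans (ENNReal.ofReal_le_ofReal h3)) _)
    (mul_le_mul_right (h2.trans (ENNReal.ofReal_le_ofReal h4)) _))
    (ofReal_p_add x.1.p _)

/-- With a set `F` of sites that does not depend on the run, the expected potential never exceeds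
its initial value. -/
theorem expect_countedRun_potential_le {l : ℝ} (hR : 1 ≤ Real.sqrt k / ε) (hl : 0 ≤ l) {N : ℕ}
    (hN : Real.sqrt k / ε ≤ 2 * N) (hlN : l ≤ Real.sqrt k / ε / (2 * N) / 2)
    (F : Set (Fin k)) (t : ℕ) (ht : t ≤ N) :
    (expect (countedRun k ε t) fun y =>
        ENNReal.ofReal (potential l {siteAt k y.2.1} F 0 y.1)) ≤ 1 := by
  have hR0 : 0 < Real.sqrt k / ε := by linarith
  induction t with
  | zero =>
    rw [countedRun, expect_pure, ← ENNReal.ofReal_one]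
    apply ENNReal.ofReal_le_ofReal
    unfold potential
    rw [Real.exp_le_one_iff]
    have h1 : ∀ j, virtualError {siteAt k 0} F 0 (State.init k) j = 0 := by
      intro j
      unfold virtualError
      split_ifs <;> simp [State.init]
    have h2 : 0 ≤ discount l (State.init k) := by unfold discount; positivity
    simp only [h1, Finset.sum_const_zero, mul_zero]
    linarith
  | succ t ih =>
    rw [countedRun_succ, expect_bind]
    refine (expect_mono fun x hx => ?_).trans (ih (by omega))
    obtain ⟨h1, h2⟩ := synced_of_mem_support_countedRun hR t x hx
    exact expect_step_potential_le hR0 hl hN hlN (F := fun _ => F) h1 (by omega) le_rfl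
      (fun j h1 h2 => (h2 h1).elim) (Or.inl rfl)

/-- The sites that the attack visits with the moves after move `c` and before move `e`. -/
def ahead (k : ℕ) [NeZero k] (c e : ℕ) : Set (Fin k) :=
  {j | ∃ c', c < c' ∧ c' < e ∧ siteAt k c' = j}

theorem ahead_eq_empty {c e : ℕ} (h : e ≤ c + 1) : ahead k c e = ∅ := by
  ext j
  simp only [ahead, Set.mem_ofPred_eq, Set.mem_empty_iff_false, iff_false, not_exists]
  intro c'
  omega

theorem ahead_mod (c q : ℕ) : ahead k c (c + q) = ahead k (c % k) (c % k + q) := by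
  have h : ∀ a, siteAt k (c + a) = siteAt k (c % k + a) := by
    intro a
    apply Fin.ext
    simp [siteAt]
  ext j
  constructor
  · rintro ⟨c', h1, h2, rfl⟩
    obtain ⟨a, rfl⟩ := Nat.exists_eq_add_of_lt h1
    exact ⟨c % k + (a + 1), by omega, by omega, (h (a + 1)).symm⟩
  · rintro ⟨c', h1, h2, rfl⟩
    obtain ⟨a, rfl⟩ := Nat.exists_eq_add_of_lt h1
    exact ⟨c + (a + 1), by omega, by omega, h (a + 1)⟩

open Classical in
theorem le_card_ahead {c q : ℕ} (hq : q ≤ k) :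
    q - 1 ≤ (Finset.univ.filter (· ∈ ahead k c (c + q))).card := by
  rw [← Finset.card_range (q - 1)]
  refine Finset.card_le_card_of_injOn (fun r => siteAt k (c + 1 + r)) ?_ ?_
  · intro r hr
    have hr' : r < q - 1 := by simpa using hr
    simp only [Finset.coe_filter, Finset.mem_univ, true_and, Set.mem_ofPred_eq]
    exact ⟨c + 1 + r, by omega, by omega, rfl⟩
  · intro r hr r' hr' h
    have h1 : r < q - 1 := by simpa using hr
    have h2 : r' < q - 1 := by simpa using hr'
    by_contra hne
    rcases lt_or_gt_of_ne hne with h3 | h3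
    · exact siteAt_ne (k := k) (c := c + 1 + r) (c' := c + 1 + r') (by omega) (by omega) h
    · exact siteAt_ne (k := k) (c := c + 1 + r') (c' := c + 1 + r) (by omega) (by omega) h.symm

/-- If all sites ahead are visited in the next `m` events, each of them contributes the error `g`
to the potential, whatever their present errors are. -/
theorem expect_stepN_potential_le {l g : ℝ} (hR : 0 < Real.sqrt k / ε) (hl : 0 ≤ l) {N : ℕ}
    (hN0 : 0 < N) (hN : Real.sqrt k / ε ≤ 2 * N) (hlN : l ≤ Real.sqrt k / ε / (2 * N) / 2)
    (hg : g ≤ N / (8 * (Real.sqrt k / ε)) - 1) (e m : ℕ) {x : State k × (ℕ × ℝ)}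
    (hx : Synced ε x) (hxN : x.1.total + m ≤ N) (hNx : N ≤ 2 * x.1.total) :
    (expect (stepN ε m x) fun y =>
        if y.2.1 < e then 0 else ENNReal.ofReal (potential l {siteAt k y.2.1} ∅ g y.1))
      ≤ ENNReal.ofReal (potential l {siteAt k x.2.1} (ahead k x.2.1 e) g x.1) := by
  refine expect_stepN_le hR (x.1.total + m)
    (V := fun _ y => ENNReal.ofReal (potential l {siteAt k y.2.1} (ahead k y.2.1 e) g y.1))
    (P := fun y => N ≤ 2 * y.1.total) ?_ ?_ ?_ m x hx rfl hNx
  · intro y y' hy hy' h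
    rw [hy.total_of_mem_support hR hy']
    omega
  · intro y _ _ _
    split_ifs with h
    · exact zero_le
    · rw [ahead_eq_empty (by omega)]
  · intro m' y hy hyT hyN
    refine expect_step_potential_le hR hl hN hlN (F := fun c => ahead k c e) hy (by omega) ?_ ?_ ?_
    · rintro j ⟨c', h1, h2, h3⟩
      exact ⟨c', by omega, h2, h3⟩
    · rintro j ⟨c', h1, h2, h3⟩ h4
      by_cases h5 : c' = y.2.1 + 1
      · rw [← h3, h5]
      · exact (h4 ⟨c', by omega, h2, h3⟩).elim
    · right
      have h1 := hy.valid.p_le hR hN0 hyN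
      have h2 := y.1.p.2.1
      have hN' : (0 : ℝ) < N := by exact_mod_cast hN0
      refine hg.trans (sub_le_sub_right ?_ 1)
      have h3 := one_div_le_one_div_of_le h2 h1
      rwa [one_div_div] at h3

/-! ### The number of moves -/

/-- Unless the sum of the estimates has been adjusted since the last report, a report increases the
published estimate, and the attack moves. -/
theorem published_lt_of_report {x : State k × (ℕ × ℝ)} (hx : Synced ε x)
    (h : x.1.published = x.1.sumEstimate) : x.2.2 < (reported x).published := by
  rw [hx.snd_eq, h, State.published_report]
  unfold State.sumEstimate
  refine Finset.sum_lt_sum (fun j _ => ?_) ⟨siteAt k x.2.1, Finset.mem_univ _, ?_⟩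
  · by_cases hj : j = siteAt k x.2.1
    · subst hj
      rw [State.nhat_report_self]
      have := hx.valid.nhat_sub_le (siteAt k x.2.1)
      simp only [State.countEvent, Function.update_self]
      push_cast
      linarith
    · rw [State.nhat_report_of_ne _ hj]
      exact le_rfl
  · rw [State.nhat_report_self]
    have := hx.valid.nhat_sub_le (siteAt k x.2.1)
    simp only [State.countEvent, Function.update_self]
    push_cast
    linarith

theorem moveWeight_reported {x : State k × (ℕ × ℝ)} (hx : Synced ε x) :
    moveWeight (reported x) (move x.2 (reported x).published).1 ≤ moveWeight x.1 x.2.1 / 2 := by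
  unfold moveWeight
  rw [if_pos (State.published_report _ _)]
  change (x.1.p : ℝ) * _ * (1 / 2) ≤ _
  have hp := x.1.p.2.1
  by_cases h : x.1.published = x.1.sumEstimate
  · rw [if_pos h, move_of_ne (published_lt_of_report hx h).ne', pow_succ]
    linarith
  · rw [if_neg h]
    have : ((1 : ℝ) / 2) ^ (move x.2 (reported x).published).1 ≤ (1 / 2) ^ x.2.1 :=
      pow_le_pow_of_le_one (by norm_num) (by norm_num) (le_fst_move _ _)
    have := mul_le_mul_of_nonneg_left this hp.le
    linarith

/-- A large deviation bound for the number of moves. -/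
theorem expect_stepN_moves_le (hR : 0 < Real.sqrt k / ε) {N : ℕ}
    (hN0 : 0 < N) (hN : Real.sqrt k / ε ≤ 2 * N) (q m : ℕ) {x : State k × (ℕ × ℝ)}
    (hx : Synced ε x) (hxN : x.1.total + m ≤ N) (hNx : N ≤ 2 * x.1.total) :
    (expect (stepN ε m x) fun y => if y.2.1 < x.2.1 + q then 1 else 0)
      ≤ ENNReal.ofReal (16 * 2 ^ q * (1 - Real.sqrt k / ε / (2 * N) / 2) ^ m) := by
  set R := Real.sqrt k / ε with hRdef
  set pm := R / (2 * N) with hpm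
  have hN' : (0 : ℝ) < N := by exact_mod_cast hN0
  have hpm0 : 0 < pm := by positivity
  have hpm1 : pm ≤ 1 := (div_le_one (by positivity)).2 hN
  set e := x.2.1 + q with he
  have key := expect_stepN_le hR (x.1.total + m)
    (V := fun m' y => ENNReal.ofReal
      ((1 - pm / 2) ^ m' * moveWeight y.1 y.2.1 * (2 ^ e / pm)))
    (f := fun y : State k × (ℕ × ℝ) => if y.2.1 < e then 1 else 0)
    (P := fun _ => True) (fun _ _ _ _ _ => trivial) ?_ ?_ m x hx rfl trivial
  · refine key.trans (ENNReal.ofReal_le_ofReal ?_)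
    have h1 : moveWeight x.1 x.2.1 ≤ x.1.p * (1 / 2) ^ x.2.1 := by
      unfold moveWeight
      have := x.1.p.2.1
      refine mul_le_of_le_one_right (by positivity) ?_
      split_ifs <;> norm_num
    have h2 : (x.1.p : ℝ) ≤ 16 * pm := by
      refine (hx.valid.p_le hR hN0 hNx).trans (le_of_eq ?_)
      rw [hpm]; field_simp; ring
    have h3 : (0 : ℝ) ≤ (1 - pm / 2) ^ m := pow_nonneg (by linarith) _
    calc (1 - pm / 2) ^ m * moveWeight x.1 x.2.1 * (2 ^ e / pm)
        ≤ (1 - pm / 2) ^ m * (16 * pm * (1 / 2) ^ x.2.1) * (2 ^ e / pm) := by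
          gcongr
          exact h1.trans (by gcongr)
      _ = 16 * ((1 / 2) ^ x.2.1 * 2 ^ e) * (1 - pm / 2) ^ m := by field_simp
      _ = 16 * 2 ^ q * (1 - pm / 2) ^ m := by
          rw [he, pow_add, ← mul_assoc ((1 / 2 : ℝ) ^ x.2.1), ← mul_pow]
          norm_num
  · intro y hy hyT _
    split_ifs with h
    · rw [← ENNReal.ofReal_one]
      apply ENNReal.ofReal_le_ofReal
      have h1 : pm ≤ y.1.p := hy.valid.le_p hR hN0 hN (by omega)
      have h2 : pm * (1 / 2) ^ e ≤ moveWeight y.1 y.2.1 := by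
        unfold moveWeight
        have hp0 : 0 ≤ (y.1.p : ℝ) := y.1.p.2.1.le
        have h3 : ((1 : ℝ) / 2) ^ e ≤ (1 / 2) ^ y.2.1 * (1 / 2) := by
          rw [← pow_succ]
          exact pow_le_pow_of_le_one (by norm_num) (by norm_num) h
        have h4 : (1 : ℝ) / 2 ≤ if y.1.published = y.1.sumEstimate then 1 / 2 else 1 := by
          split_ifs <;> norm_num
        calc pm * (1 / 2) ^ e ≤ y.1.p * ((1 / 2) ^ y.2.1 * (1 / 2)) := by gcongr
          _ = y.1.p * (1 / 2) ^ y.2.1 * (1 / 2) := by ring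
          _ ≤ _ := by gcongr
      calc (1 : ℝ) = (1 - pm / 2) ^ 0 * (pm * (1 / 2) ^ e) * (2 ^ e / pm) := by
            have : ((1 : ℝ) / 2) ^ e * 2 ^ e = 1 := by rw [← mul_pow]; norm_num
            rw [pow_zero, one_mul, mul_assoc, mul_div_assoc', this, mul_one_div,
              div_self hpm0.ne']
        _ ≤ _ := by gcongr
    · exact zero_le
  · intro m' y hy hyT _
    rw [expect_step hR hy]
    have h1 : pm ≤ y.1.p := hy.valid.le_p hR hN0 hN (by omega)
    have hb : 0 ≤ 1 - pm / 2 := by linarith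
    set W := moveWeight y.1 y.2.1 with hW
    have hW0 : 0 ≤ W := moveWeight_nonneg _ _
    set K := (2 : ℝ) ^ e / pm with hK
    have hK0 : 0 ≤ K := by positivity
    have hT : expect ((reported y).settle ε (siteAt k y.2.1)) (fun s =>
        ENNReal.ofReal ((1 - pm / 2) ^ m' *
          moveWeight s (move y.2 (reported y).published).1 * K))
        ≤ ENNReal.ofReal ((1 - pm / 2) ^ m' * (W / 2) * K) := by
      rw [← expect_const ((reported y).settle ε (siteAt k y.2.1)) (ENNReal.ofReal _)]
      refine expect_mono fun s hs => ENNReal.ofReal_le_ofReal ?_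
      have hS := State.settled_of_mem_support hR (hy.valid.consistent_report _)
        (hy.valid.pending_report _) hs
      have := (moveWeight_settled hS (move y.2 (reported y).published).1).trans
        (moveWeight_reported hy)
      gcongr
    have hF : expect ((silent y).settle ε (siteAt k y.2.1)) (fun s =>
        ENNReal.ofReal ((1 - pm / 2) ^ m' * moveWeight s y.2.1 * K))
        ≤ ENNReal.ofReal ((1 - pm / 2) ^ m' * W * K) := by
      rw [← expect_const ((silent y).settle ε (siteAt k y.2.1)) (ENNReal.ofReal _)]
      refine expect_mono fun s hs => ENNReal.ofReal_le_ofReal ?_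
      have hS := State.settled_of_mem_support hR (hy.valid.consistent_countEvent _)
        (hy.valid.pending_countEvent _) hs
      have : moveWeight s y.2.1 ≤ W := moveWeight_settled hS y.2.1
      gcongr
    refine (add_le_add (mul_le_mul_right hT _) (mul_le_mul_right hF _)).trans ?_
    have hp1 : 0 ≤ 1 - (y.1.p : ℝ) := sub_nonneg.2 y.1.p.2.2
    rw [← ENNReal.ofReal_mul y.1.p.2.1.le, ← ENNReal.ofReal_mul hp1,
      ← ENNReal.ofReal_add (mul_nonneg y.1.p.2.1.le (by positivity)) (by positivity)]
    apply ENNReal.ofReal_le_ofReal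
    have : (y.1.p : ℝ) * ((1 - pm / 2) ^ m' * (W / 2) * K)
        + (1 - y.1.p) * ((1 - pm / 2) ^ m' * W * K)
        = (1 - y.1.p / 2) * ((1 - pm / 2) ^ m' * W * K) := by ring
    rw [this, pow_succ]
    have h2 : 1 - (y.1.p : ℝ) / 2 ≤ 1 - pm / 2 := by linarith
    have h3 := mul_le_mul_of_nonneg_right h2
      (show 0 ≤ (1 - pm / 2) ^ m' * W * K by positivity)
    linarith

end Run

/-! ### The last phase: from the potential to the estimates -/

section Estimator

variable {k : ℕ}

/-- The discounted exponential moment of the error of an estimate of the total count. -/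
def estPotential (l : ℝ) (est : State k → ℝ) (s : State k) : ℝ :=
  Real.exp (-l * (est s - s.total) - discount l s)

/-- An estimate of the total count that agrees with the sum of the estimates of the sites after
each report, does not change when an event is not reported, and whose exponential moment does
not increase when a round starts. -/
structure IsEstimator (ε l : ℝ) (N : ℕ) (est : State k → ℝ) : Prop where
  countEvent : ∀ (s : State k) (i : Fin k), est (s.countEvent i) = est s
  report : ∀ (s : State k) (i : Fin k), est (s.report i) = (s.report i).sumEstimate
  nonneg : ∀ s : State k, s.Consistent ε → 0 ≤ est s
  settle : ∀ (s : State k) (i : Fin k), s.Consistent ε → State.Pending s i → s.total ≤ N →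
    (expect (s.settle ε i) fun s' => ENNReal.ofReal (estPotential l est s'))
      ≤ ENNReal.ofReal (estPotential l est s)

theorem isEstimator_sumEstimate {ε l : ℝ} (hR : 0 < Real.sqrt k / ε) (hl : 0 ≤ l) {N : ℕ}
    (hN : Real.sqrt k / ε ≤ 2 * N) (hlN : l ≤ Real.sqrt k / ε / (2 * N) / 2) :
    IsEstimator ε l N (State.sumEstimate (k := k)) where
  countEvent _ _ := rfl
  report _ _ := rfl
  nonneg _ h := h.sumEstimate_nonneg
  settle s i hs _ hsN := by
    have h := expect_settle_potential_le (i := i) hR hl hN hlN ∅ ∅ 0 hs hsN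
    simp only [potential_empty] at h
    exact h

theorem isEstimator_published {ε l : ℝ} (hR : 0 < Real.sqrt k / ε) (hl : 0 ≤ l) (N : ℕ) :
    IsEstimator ε l N (State.published (k := k)) where
  countEvent _ _ := rfl
  report _ _ := rfl
  nonneg _ h := h.published_nonneg
  settle s i hs hp _ := by
    rw [← expect_const (s.settle ε i) (ENNReal.ofReal _)]
    refine expect_mono fun s' hs' => ENNReal.ofReal_le_ofReal ?_
    have hS := State.settled_of_mem_support hR hs hp hs'
    unfold estPotential discount
    rw [hS.published_eq, hS.total_eq]
    apply Real.exp_le_exp.2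
    have h0 := s'.p.2.1
    have h1 : l / s.p ≤ l / s'.p := div_le_div_of_nonneg_left hl h0 hS.p_le_p
    have h2 : 0 ≤ l / s.p := div_nonneg hl s.p.2.1.le
    have h3 : (l / (s.p : ℝ)) ^ 2 ≤ (l / s'.p) ^ 2 := pow_le_pow_left₀ h2 h1 2
    have h4 := mul_le_mul_of_nonneg_left h3 (show (0 : ℝ) ≤ 4 * k by positivity)
    linarith

theorem expect_add_mul_le {α : Type*} (μ : PMF α) {a b : ℝ} (ha : 0 ≤ a) (hb : 0 ≤ b)
    {f g : α → ℝ} (hf : ∀ x, 0 ≤ f x) (hg : ∀ x, 0 ≤ g x) {u v : ℝ} (hu : 0 ≤ u) (hv : 0 ≤ v)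
    (h1 : (expect μ fun x => ENNReal.ofReal (f x)) ≤ ENNReal.ofReal u)
    (h2 : (expect μ fun x => ENNReal.ofReal (g x)) ≤ ENNReal.ofReal v) :
    (expect μ fun x => ENNReal.ofReal (a * f x + b * g x)) ≤ ENNReal.ofReal (a * u + b * v) := by
  have h : ∀ x, ENNReal.ofReal (a * f x + b * g x)
      = ENNReal.ofReal a * ENNReal.ofReal (f x) + ENNReal.ofReal b * ENNReal.ofReal (g x) := by
    intro x
    rw [ENNReal.ofReal_add (mul_nonneg ha (hf x)) (mul_nonneg hb (hg x)), ENNReal.ofReal_mul ha,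
      ENNReal.ofReal_mul hb]
  simp only [h]
  rw [expect_add, expect_const_mul, expect_const_mul,
    ENNReal.ofReal_add (mul_nonneg ha hu) (mul_nonneg hb hv), ENNReal.ofReal_mul ha,
    ENNReal.ofReal_mul hb]
  exact add_le_add (mul_le_mul_right h1 _) (mul_le_mul_right h2 _)

end Estimator

section LastPhase

variable {k : ℕ} [NeZero k] {ε : ℝ}

/-- The exponential moment of the error of the estimate is at most the potential at each report, and
grows by a factor `exp l` with each event that is not reported. As `l` is small compared with the
transmission probability, what is left of its initial value decays exponentially. -/
theorem expect_stepN_estPotential_le {l : ℝ} (hR : 0 < Real.sqrt k / ε) (hl : 0 ≤ l) {N : ℕ}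
    (hN0 : 0 < N) (hN : Real.sqrt k / ε ≤ 2 * N) (hlN : l ≤ Real.sqrt k / ε / (2 * N) / 4)
    {est : State k → ℝ} (hest : IsEstimator ε l N est) (g : ℝ) (m : ℕ) {x : State k × (ℕ × ℝ)}
    (hx : Synced ε x) (hxN : x.1.total + m ≤ N) (hNx : N ≤ 2 * x.1.total) :
    (expect (stepN ε m x) fun y => ENNReal.ofReal (estPotential l est y.1))
      ≤ ENNReal.ofReal (64 * potential l {siteAt k x.2.1} ∅ g x.1
        + (1 - Real.sqrt k / ε / (2 * N) / 4) ^ m * estPotential l est x.1) := by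
  set R := Real.sqrt k / ε with hRdef
  set pm := R / (2 * N) with hpm
  have hN' : (0 : ℝ) < N := by exact_mod_cast hN0
  have hpm0 : 0 < pm := by positivity
  have hpm1 : pm ≤ 1 := (div_le_one (by positivity)).2 hN
  have hβ0 : 0 ≤ 1 - pm / 4 := by linarith
  have hB : ∀ m' : ℕ, 0 ≤ 16 * pm * ∑ r ∈ Finset.range m', (1 - pm / 4) ^ r := fun m' =>
    mul_nonneg (by positivity) (Finset.sum_nonneg fun r _ => pow_nonneg hβ0 r)
  have key := expect_stepN_le hR (x.1.total + m)
    (V := fun m' y => ENNReal.ofReal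
      ((16 * pm * ∑ r ∈ Finset.range m', (1 - pm / 4) ^ r)
          * potential l {siteAt k y.2.1} ∅ g y.1
        + (1 - pm / 4) ^ m' * estPotential l est y.1))
    (f := fun y => ENNReal.ofReal (estPotential l est y.1))
    (P := fun y => N ≤ 2 * y.1.total) ?_ ?_ ?_ m x hx rfl hNx
  · refine key.trans (ENNReal.ofReal_le_ofReal ?_)
    have h1 : 16 * pm * ∑ r ∈ Finset.range m, (1 - pm / 4) ^ r ≤ 64 := by
      have h2 := geom_sum_mul_neg (1 - pm / 4) m
      have h3 : 0 ≤ (1 - pm / 4) ^ m := pow_nonneg hβ0 m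
      rw [sub_sub_cancel] at h2
      linarith
    have h2 := potential_pos l {siteAt k x.2.1} ∅ g x.1
    gcongr
  · intro y y' hy hy' h
    rw [hy.total_of_mem_support hR hy']
    omega
  · intro y _ _ _
    simp
  · intro m' y hy hyT hyN
    have hT' : (reported y).total ≤ N := by rw [total_reported]; omega
    have hF' : (silent y).total ≤ N := by rw [total_silent]; omega
    have hlN' : l ≤ R / (2 * N) / 2 := by rw [← hpm]; linarith
    have p1 : pm ≤ y.1.p := hy.valid.le_p hR hN0 hN (by omega)
    have p2 : (y.1.p : ℝ) ≤ 16 * pm := by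
      refine (hy.valid.p_le hR hN0 hyN).trans (le_of_eq ?_)
      rw [hpm]; field_simp; ring
    have hp0 : 0 ≤ (y.1.p : ℝ) := y.1.p.2.1.le
    have hp1 : 0 ≤ 1 - (y.1.p : ℝ) := sub_nonneg.2 y.1.p.2.2
    set Φ := potential l {siteAt k y.2.1} ∅ g y.1 with hΦ
    have hΦ0 : 0 < Φ := potential_pos _ _ _ _ _
    set W := estPotential l est y.1 with hW
    have hW0 : 0 < W := Real.exp_pos _
    set B := 16 * pm * ∑ r ∈ Finset.range m', (1 - pm / 4) ^ r with hBdef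
    have hB0 : 0 ≤ B := hB m'
    set b := (1 - pm / 4) ^ m' with hb
    have hb0 : 0 ≤ b := pow_nonneg hβ0 _
    have a1 := (expect_settle_potential_le (i := siteAt k y.2.1) hR hl hN hlN'
      {siteAt k (move y.2 (reported y).published).1} ∅ g
      (hy.valid.consistent_report _) hT')
    have a2 := (expect_settle_potential_le (i := siteAt k y.2.1) hR hl hN hlN'
      {siteAt k y.2.1} ∅ g (hy.valid.consistent_countEvent _) hF')
    have a3 := hest.settle (reported y) (siteAt k y.2.1) (hy.valid.consistent_report _)
      (hy.valid.pending_report _) hT'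
    have a4 := hest.settle (silent y) (siteAt k y.2.1) (hy.valid.consistent_countEvent _)
      (hy.valid.pending_countEvent _) hF'
    have e1 : potential l {siteAt k (move y.2 (reported y).published).1} ∅ g (reported y) ≤ Φ :=
      potential_report_le hl hy.valid le_rfl (fun j h1 h2 => (h2 h1).elim) (Or.inl rfl)
    have e2 : potential l {siteAt k y.2.1} ∅ g (silent y) ≤ Φ :=
      potential_countEvent hl _ (Set.mem_singleton _)
    have e3 : estPotential l est (reported y) ≤ Φ := by
      have h : estPotential l est (reported y) = potential l ∅ ∅ g (reported y) := by
        rw [potential_empty, estPotential, hest.report]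
      rw [h]
      exact potential_report_le hl hy.valid le_rfl (fun j h1 h2 => (h2 h1).elim) (Or.inl rfl)
    have e4 : estPotential l est (silent y) = Real.exp l * W := by
      rw [hW]
      unfold estPotential
      rw [hest.countEvent, total_silent, ← Real.exp_add]
      congr 1
      change _ - discount l y.1 = _
      push_cast
      ring
    have b1 := expect_add_mul_le _ hB0 hb0 (fun s => (potential_pos _ _ _ _ s).le)
      (fun s => (Real.exp_pos _).le) (potential_pos _ _ _ _ _).le (Real.exp_pos _).le a1 a3
    have b2 := expect_add_mul_le _ hB0 hb0 (fun s => (potential_pos _ _ _ _ s).le)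
      (fun s => (Real.exp_pos _).le) (potential_pos _ _ _ _ _).le (Real.exp_pos _).le a2 a4
    have c1 : B * potential l {siteAt k (move y.2 (reported y).published).1} ∅ g (reported y)
        + b * estPotential l est (reported y) ≤ B * Φ + b * Φ := by gcongr
    have c2 : B * potential l {siteAt k y.2.1} ∅ g (silent y)
        + b * estPotential l est (silent y) ≤ B * Φ + b * (Real.exp l * W) := by
      rw [e4]; gcongr
    rw [expect_step hR hy]
    refine (add_le_add (mul_le_mul_right (b1.trans (ENNReal.ofReal_le_ofReal c1)) _)
      (mul_le_mul_right (b2.trans (ENNReal.ofReal_le_ofReal c2)) _)).trans ?_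
    rw [← ENNReal.ofReal_mul hp0, ← ENNReal.ofReal_mul hp1,
      ← ENNReal.ofReal_add (by positivity) (by positivity)]
    apply ENNReal.ofReal_le_ofReal
    rw [Finset.sum_range_succ, pow_succ, mul_add (16 * pm), ← hBdef, ← hb]
    have d1 : (1 - (y.1.p : ℝ)) * Real.exp l ≤ 1 - pm / 4 := by
      have h1 : Real.exp l * (1 - l) ≤ 1 := by
        have h2 := Real.add_one_le_exp (-l)
        have h3 : Real.exp l * Real.exp (-l) = 1 := by rw [← Real.exp_add]; simp
        have h4 := Real.exp_pos l
        nlinarith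
      have h5 : (1 - (y.1.p : ℝ)) ≤ (1 - pm / 4) * (1 - l) := by nlinarith
      have h4 := Real.exp_pos l
      nlinarith
    have d2 := mul_le_mul_of_nonneg_right d1 (mul_nonneg hb0 hW0.le)
    have d3 := mul_le_mul_of_nonneg_right p2 (mul_nonneg hb0 hΦ0.le)
    linarith

/-- After sufficiently many events, the contribution of the initial estimate is negligible. -/
theorem expect_stepN_estPotential_le_potential {l : ℝ} (hR : 0 < Real.sqrt k / ε) (hl : 0 ≤ l)
    {N : ℕ} (hN0 : 0 < N) (hN : Real.sqrt k / ε ≤ 2 * N)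
    (hlN : l ≤ Real.sqrt k / ε / (2 * N) / 4)
    {est : State k → ℝ} (hest : IsEstimator ε l N est) (g : ℝ) (m : ℕ) {x : State k × (ℕ × ℝ)}
    (hx : Synced ε x) (hxN : x.1.total + m ≤ N) (hNx : N ≤ 2 * x.1.total)
    (hm : l * N + l * k / (Real.sqrt k / ε / (2 * N)) ≤ Real.sqrt k / ε / (2 * N) / 4 * m) :
    (expect (stepN ε m x) fun y => ENNReal.ofReal (estPotential l est y.1))
      ≤ ENNReal.ofReal (65 * potential l {siteAt k x.2.1} ∅ g x.1) := by
  refine (expect_stepN_estPotential_le hR hl hN0 hN hlN hest g m hx hxN hNx).trans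
    (ENNReal.ofReal_le_ofReal ?_)
  set R := Real.sqrt k / ε with hRdef
  set pm := R / (2 * N) with hpm
  have hN' : (0 : ℝ) < N := by exact_mod_cast hN0
  have hpm0 : 0 < pm := by positivity
  have hpm1 : pm ≤ 1 := (div_le_one (by positivity)).2 hN
  have p1 : pm ≤ x.1.p := hx.valid.le_p hR hN0 hN (by omega)
  have hp0 := x.1.p.2.1
  have h1 : (1 - pm / 4) ^ m ≤ Real.exp (-(pm / 4 * m)) := by
    have h2 : 1 - pm / 4 ≤ Real.exp (-(pm / 4)) := Real.one_sub_le_exp_neg _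
    calc (1 - pm / 4) ^ m ≤ Real.exp (-(pm / 4)) ^ m := pow_le_pow_left₀ (by linarith) h2 m
      _ = _ := by rw [← Real.exp_nat_mul]; congr 1; ring
  have h2 : estPotential l est x.1 ≤ Real.exp (l * N - discount l x.1) := by
    unfold estPotential
    apply Real.exp_le_exp.2
    have h3 := hest.nonneg x.1 hx.valid.toConsistent
    have h4 : (x.1.total : ℝ) ≤ N := by exact_mod_cast (by omega : x.1.total ≤ N)
    have h5 := mul_le_mul_of_nonneg_left h4 hl
    have h6 := mul_nonneg hl h3
    linarith
  have h3 : Real.exp (-(l * k / pm) - discount l x.1)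
      ≤ potential l {siteAt k x.2.1} ∅ g x.1 := by
    unfold potential
    apply Real.exp_le_exp.2
    have h4 : ∑ j, virtualError {siteAt k x.2.1} ∅ g x.1 j ≤ k / pm := by
      have : ∀ j ∈ Finset.univ, virtualError {siteAt k x.2.1} ∅ g x.1 j ≤ 1 / pm := by
        intro j _
        have h5 : 1 / (x.1.p : ℝ) ≤ 1 / pm := one_div_le_one_div_of_le hpm0 p1
        unfold virtualError
        rw [if_neg (Set.notMem_empty j)]
        split_ifs
        · linarith
        · have := hx.valid.nhat_sub_le j
          linarith
      refine (Finset.sum_le_sum this).trans (le_of_eq ?_)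
      rw [Finset.sum_const, Finset.card_univ, Fintype.card_fin, nsmul_eq_mul, mul_one_div]
    have h5 := mul_le_mul_of_nonneg_left h4 hl
    rw [mul_div_assoc]
    linarith
  have h4 : (1 - pm / 4) ^ m * estPotential l est x.1
      ≤ potential l {siteAt k x.2.1} ∅ g x.1 := by
    calc _ ≤ Real.exp (-(pm / 4 * m)) * Real.exp (l * N - discount l x.1) := by
          have : 0 ≤ estPotential l est x.1 := (Real.exp_pos _).le
          gcongr
      _ ≤ Real.exp (-(l * k / pm) - discount l x.1) := by
          rw [← Real.exp_add]
          apply Real.exp_le_exp.2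
          linarith
      _ ≤ _ := h3
  linarith

end LastPhase

/-! ### Many sites -/

section ManySites

variable {k : ℕ} [NeZero k] {ε : ℝ}

/-- The sites ahead of the attack depend on the run only through the current site, so that a union
bound over the `k` possible current sites applies. -/
theorem expect_countedRun_ahead_le {l g : ℝ} (hR : 1 ≤ Real.sqrt k / ε) (hl : 0 ≤ l) (hg : 0 ≤ g)
    {N : ℕ} (hN : Real.sqrt k / ε ≤ 2 * N) (hlN : l ≤ Real.sqrt k / ε / (2 * N) / 2)
    {q : ℕ} (hq : q ≤ k) (t : ℕ) (ht : t ≤ N) :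
    (expect (countedRun k ε t) fun y => ENNReal.ofReal
        (potential l {siteAt k y.2.1} (ahead k y.2.1 (y.2.1 + q)) g y.1))
      ≤ ENNReal.ofReal (k * Real.exp (-(l * g * (q - 1 : ℕ)))) := by
  classical
  have hk : 0 < k := Nat.pos_of_ne_zero (NeZero.ne k)
  set C := Real.exp (-(l * g * (q - 1 : ℕ))) with hC
  have h1 : ∀ y : State k × (ℕ × ℝ), ENNReal.ofReal
      (potential l {siteAt k y.2.1} (ahead k y.2.1 (y.2.1 + q)) g y.1)
      ≤ ENNReal.ofReal C * ∑ i ∈ Finset.range k,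
        ENNReal.ofReal (potential l {siteAt k y.2.1} (ahead k i (i + q)) 0 y.1) := by
    intro y
    have h2 : potential l {siteAt k y.2.1} (ahead k y.2.1 (y.2.1 + q)) g y.1
        ≤ C * potential l {siteAt k y.2.1} (ahead k (y.2.1 % k) (y.2.1 % k + q)) 0 y.1 := by
      rw [potential_frozen, ahead_mod]
      refine mul_le_mul_of_nonneg_right ?_ (potential_pos _ _ _ _ _).le
      apply Real.exp_le_exp.2
      have h3 : ((q - 1 : ℕ) : ℝ) ≤
          (Finset.univ.filter (· ∈ ahead k (y.2.1 % k) (y.2.1 % k + q))).card := by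
        exact_mod_cast le_card_ahead hq
      have := mul_le_mul_of_nonneg_left h3 (mul_nonneg hl hg)
      linarith
    refine (ENNReal.ofReal_le_ofReal h2).trans ?_
    rw [ENNReal.ofReal_mul (Real.exp_pos _).le]
    refine mul_le_mul_right ?_ _
    exact Finset.single_le_sum
      (f := fun i => ENNReal.ofReal (potential l {siteAt k y.2.1} (ahead k i (i + q)) 0 y.1))
      (fun i _ => zero_le) (Finset.mem_range.2 (Nat.mod_lt _ hk))
  refine (expect_mono fun y _ => h1 y).trans ?_
  rw [expect_const_mul, expect_finset_sum]
  calc _ ≤ ENNReal.ofReal C * ∑ i ∈ Finset.range k, 1 := by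
        refine mul_le_mul_right (Finset.sum_le_sum fun i _ => ?_) _
        exact expect_countedRun_potential_le hR hl hN hlN _ t ht
    _ = _ := by
        rw [Finset.sum_const, Finset.card_range, nsmul_eq_mul, mul_one, mul_comm (k : ℝ),
          ENNReal.ofReal_mul (Real.exp_pos _).le, ENNReal.ofReal_natCast]

/-- With many sites, the probability of a small error decreases exponentially with their
number. -/
theorem expect_small_error_le (hk : 160 ≤ k) (hR : (k : ℝ) ≤ Real.sqrt k / ε) {n : ℕ}
    (hn : 64 * (Real.sqrt k / ε) < n) {est : State k → ℝ}
    (hest : IsEstimator ε (Real.sqrt k / ε / (2 * n) / 2 ^ 14) n est) :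
    (expect (countedRun k ε n) fun y =>
        if est y.1 - n ≤ 1 / 2 ^ 14 * k * n / (Real.sqrt k / ε) then 1 else 0)
      ≤ ENNReal.ofReal (16 * Real.exp (-(k / 40))
        + 65 * k * Real.exp (-(k / (2 ^ 14 * 10000)))) := by
  have hk' : (160 : ℝ) ≤ k := by exact_mod_cast hk
  set R := Real.sqrt k / ε with hRdef
  have hR1 : 1 ≤ R := by linarith
  have hR0 : 0 < R := by linarith
  have hn' : (0 : ℝ) < n := by linarith
  have hn0 : 0 < n := by exact_mod_cast hn'
  have hn64 : 10240 < n := by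
    have : (10240 : ℝ) < n := by linarith
    exact_mod_cast this
  set pm := R / (2 * n) with hpm
  have hpm0 : 0 < pm := by positivity
  have hpmn : pm * n = R / 2 := by rw [hpm]; field_simp
  set l := pm / 2 ^ 14 with hl
  have hl0 : 0 ≤ l := by positivity
  have hln : l * n = R / 2 ^ 15 := by
    rw [hl, div_mul_eq_mul_div, hpmn]; ring
  have hN : R ≤ 2 * n := by linarith
  have hlN4 : l ≤ pm / 4 := by rw [hl]; gcongr; norm_num
  have hlN2 : l ≤ pm / 2 := by linarith
  -- `m` events are left for each of the two last phases
  set m := n / 4 with hm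
  have hm5 : (n : ℝ) / 5 ≤ m := by
    have : n ≤ 5 * m := by omega
    have : (n : ℝ) ≤ 5 * m := by exact_mod_cast this
    linarith
  set u := n - m - m with hu
  have hnum : n = u + m + m := by omega
  have hu2 : n ≤ 2 * u := by omega
  -- the number of moves that are expected with high probability in the second phase
  set q := k / 40 with hq
  have hqk : q ≤ k := by omega
  have hq1 : (k : ℝ) / 80 ≤ (q - 1 : ℕ) := by
    have : k ≤ 80 * (q - 1) := by omega
    have : (k : ℝ) ≤ 80 * (q - 1 : ℕ) := by exact_mod_cast this
    linarith
  have hq2 : (q : ℝ) ≤ k / 40 := by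
    have : 40 * q ≤ k := by omega
    have : (40 : ℝ) * q ≤ k := by exact_mod_cast this
    linarith
  -- a lower bound for `1 / p - 1` in the second half of the events
  set g := n / (8 * R) - 1 with hg
  have hg0 : 0 ≤ g := by
    rw [hg, sub_nonneg, le_div_iff₀ (by positivity)]; linarith
  have hlg : 1 / (2 ^ 14 * 32) ≤ l * g := by
    have h1 : l * g = (pm * n) / (8 * R) / 2 ^ 14 - l := by rw [hg, hl]; ring
    rw [h1, hpmn]
    have h2 : l ≤ 1 / 2 ^ 14 / 32 := by
      rw [hl, div_div, div_le_div_iff₀ (by positivity) (by positivity)]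
      have : pm ≤ 1 / 64 := by
        rw [hpm, div_le_div_iff₀ (by positivity) (by norm_num)]; linarith
      linarith
    have h3 : R / 2 / (8 * R) / 2 ^ 14 = 1 / 2 ^ 14 / 16 := by field_simp; norm_num
    rw [h3]
    linarith
  -- the loss in Markov's inequality, from the size of the error and from the final discount
  set K := Real.exp (l * (1 / 2 ^ 14 * k * n / R) + 4 * k * (1 / 2 ^ 14) ^ 2) with hK
  have hK0 : 0 < K := Real.exp_pos _
  -- the last phase
  have h3 : ∀ z : State k × (ℕ × ℝ), Synced ε z → z.1.total = u + m →
      (expect (stepN ε m z) fun y =>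
        if est y.1 - n ≤ 1 / 2 ^ 14 * k * n / R then 1 else 0)
        ≤ ENNReal.ofReal (65 * K) * ENNReal.ofReal (potential l {siteAt k z.2.1} ∅ g z.1) := by
    intro z hz hzt
    have h4 : ∀ y ∈ (stepN ε m z).support,
        (if est y.1 - n ≤ 1 / 2 ^ 14 * k * n / R then (1 : ℝ≥0∞) else 0)
          ≤ ENNReal.ofReal K * ENNReal.ofReal (estPotential l est y.1) := by
      intro y hy
      obtain ⟨hy1, hy2⟩ := synced_of_mem_support_stepN hR0 m z hz y hy
      split_ifs with hbad
      · rw [← ENNReal.ofReal_mul hK0.le, ← ENNReal.ofReal_one]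
        apply ENNReal.ofReal_le_ofReal
        rw [hK, estPotential, ← Real.exp_add]
        apply Real.one_le_exp
        have hp : pm ≤ y.1.p := hy1.valid.le_p hR0 hn0 hN (by omega)
        have hlp : l / y.1.p ≤ 1 / 2 ^ 14 := by
          rw [div_le_iff₀ y.1.p.2.1, hl]
          linarith
        have hlp0 : 0 ≤ l / y.1.p := div_nonneg hl0 y.1.p.2.1.le
        have hd : discount l y.1 ≤ 4 * k * (1 / 2 ^ 14) ^ 2 := by
          unfold discount
          gcongr
        have ht : (y.1.total : ℝ) = n := by
          have : y.1.total = n := by omega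
          exact_mod_cast this
        rw [ht]
        have := mul_le_mul_of_nonneg_left hbad hl0
        linarith
      · exact zero_le
    refine (expect_mono h4).trans ?_
    rw [expect_const_mul, mul_comm (65 : ℝ), ENNReal.ofReal_mul hK0.le, mul_assoc,
      ← ENNReal.ofReal_mul (by norm_num)]
    refine mul_le_mul_right ?_ _
    refine expect_stepN_estPotential_le_potential hR0 hl0 hn0 hN hlN4 hest g m hz (by omega)
      (by omega) ?_
    rw [← hRdef, ← hpm, hln]
    have e1 : l * k / pm = k / 2 ^ 14 := by rw [hl]; field_simp
    have e2 : R / 40 ≤ pm / 4 * m := by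
      calc R / 40 = pm / 4 * (n / 5) := by rw [div_mul_div_comm, hpmn]; ring
        _ ≤ _ := by gcongr
    rw [e1]
    linarith
  -- the last two phases
  have h2 : ∀ x : State k × (ℕ × ℝ), Synced ε x → x.1.total = u →
      (expect (stepN ε m x) fun z => expect (stepN ε m z) fun y =>
        if est y.1 - n ≤ 1 / 2 ^ 14 * k * n / R then 1 else 0)
        ≤ ENNReal.ofReal (16 * 2 ^ q * (1 - pm / 2) ^ m) + ENNReal.ofReal (65 * K)
          * ENNReal.ofReal (potential l {siteAt k x.2.1} (ahead k x.2.1 (x.2.1 + q)) g x.1) := by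
    intro x hx hxt
    have h4 : ∀ z ∈ (stepN ε m x).support,
        (expect (stepN ε m z) fun y =>
          if est y.1 - n ≤ 1 / 2 ^ 14 * k * n / R then 1 else 0)
          ≤ (if z.2.1 < x.2.1 + q then 1 else 0) + ENNReal.ofReal (65 * K) *
            if z.2.1 < x.2.1 + q then 0
              else ENNReal.ofReal (potential l {siteAt k z.2.1} ∅ g z.1) := by
      intro z hz
      obtain ⟨hz1, hz2⟩ := synced_of_mem_support_stepN hR0 m x hx z hz
      split_ifs with h
      · rw [mul_zero, add_zero]
        refine (expect_mono (g := fun _ => 1) fun y _ => ?_).trans (expect_const _ 1).le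
        split_ifs
        · exact le_rfl
        · exact zero_le
      · rw [zero_add]
        exact h3 z hz1 (by omega)
    refine (expect_mono h4).trans ?_
    rw [expect_add, expect_const_mul]
    refine add_le_add ?_ (mul_le_mul_right ?_ _)
    · exact expect_stepN_moves_le hR0 hn0 hN q m hx (by omega) (by omega)
    · exact expect_stepN_potential_le hR0 hl0 hn0 hN hlN2 le_rfl (x.2.1 + q) m hx (by omega)
        (by omega)
  rw [show countedRun k ε n = ((countedRun k ε u).bind (stepN ε m)).bind (stepN ε m) by
    rw [← countedRun_add, ← countedRun_add, ← hnum], expect_bind, expect_bind]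
  refine (expect_mono (g := fun x => ENNReal.ofReal (16 * 2 ^ q * (1 - pm / 2) ^ m)
      + ENNReal.ofReal (65 * K) * ENNReal.ofReal
        (potential l {siteAt k x.2.1} (ahead k x.2.1 (x.2.1 + q)) g x.1))
    fun x hx => ?_).trans ?_
  · obtain ⟨hx1, hx2⟩ := synced_of_mem_support_countedRun hR1 u x hx
    exact h2 x hx1 hx2
  · rw [expect_add, expect_const, expect_const_mul]
    refine (add_le_add_right (mul_le_mul_right
      (expect_countedRun_ahead_le hR1 hl0 hg0 hN hlN2 hqk u (by omega)) _) _).trans ?_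
    rw [← ENNReal.ofReal_mul (by positivity)]
    have hpm2 : 0 ≤ 1 - pm / 2 := by
      have : pm ≤ 1 := (div_le_one (by positivity)).2 hN
      linarith
    rw [← ENNReal.ofReal_add (by positivity) (by positivity)]
    apply ENNReal.ofReal_le_ofReal
    apply add_le_add
    · -- `2 ^ q ≤ exp q`, and about `R / 20` reports are expected
      have e1 : (2 : ℝ) ^ q ≤ Real.exp (k / 40) := by
        have h2 : (2 : ℝ) ≤ Real.exp 1 := by have := Real.add_one_le_exp (1 : ℝ); linarith
        calc (2 : ℝ) ^ q ≤ Real.exp 1 ^ q := pow_le_pow_left₀ (by norm_num) h2 q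
          _ = Real.exp q := by rw [← Real.exp_nat_mul, mul_one]
          _ ≤ _ := Real.exp_le_exp.2 hq2
      have e2 : (1 - pm / 2) ^ m ≤ Real.exp (-(k / 20)) := by
        calc (1 - pm / 2) ^ m ≤ Real.exp (-(pm / 2)) ^ m :=
              pow_le_pow_left₀ hpm2 (Real.one_sub_le_exp_neg _) m
          _ = Real.exp (-(pm / 2 * m)) := by rw [← Real.exp_nat_mul]; congr 1; ring
          _ ≤ _ := by
              apply Real.exp_le_exp.2
              have : R / 20 ≤ pm / 2 * m := by
                calc R / 20 = pm / 2 * (n / 5) := by rw [div_mul_div_comm, hpmn]; ring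
                  _ ≤ _ := by gcongr
              linarith
      calc 16 * 2 ^ q * (1 - pm / 2) ^ m
          ≤ 16 * Real.exp (k / 40) * Real.exp (-(k / 20)) := by
            have := pow_nonneg hpm2 m
            gcongr
        _ = 16 * Real.exp (-(k / 40)) := by
            rw [mul_assoc, ← Real.exp_add]; congr 2; ring
    · have e1 : 65 * K * (k * Real.exp (-(l * g * (q - 1 : ℕ))))
          = 65 * k * Real.exp (l * (1 / 2 ^ 14 * k * n / R) + 4 * k * (1 / 2 ^ 14) ^ 2
            + -(l * g * (q - 1 : ℕ))) := by
        rw [Real.exp_add _ (-(l * g * (q - 1 : ℕ)))]; ring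
      rw [e1]
      have e2 : l * (1 / 2 ^ 14 * k * n / R) = k / 2 ^ 29 := by
        have : l * (1 / 2 ^ 14 * k * n / R) = (l * n) * k / R / 2 ^ 14 := by ring
        rw [this, hln]; field_simp
      have e3 : (k : ℝ) / (2 ^ 14 * 2560) ≤ l * g * (q - 1 : ℕ) := by
        calc (k : ℝ) / (2 ^ 14 * 2560) = 1 / (2 ^ 14 * 32) * (k / 80) := by ring
          _ ≤ _ := mul_le_mul hlg hq1 (by positivity) (mul_nonneg hl0 hg0)
      rw [e2]
      gcongr
      have : (k : ℝ) / 2 ^ 29 + 4 * k * (1 / 2 ^ 14) ^ 2 + k / (2 ^ 14 * 10000)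
          ≤ k / (2 ^ 14 * 2560) := by
        have h5 : (1 : ℝ) / 2 ^ 29 + 4 * (1 / 2 ^ 14) ^ 2 + 1 / (2 ^ 14 * 10000)
          ≤ 1 / (2 ^ 14 * 2560) := by norm_num
        have := mul_le_mul_of_nonneg_left h5 (show (0 : ℝ) ≤ k by linarith)
        linarith
      linarith

end ManySites

/-! ### Tails of the binomial distribution -/

/-- The probability of at least `r` successes in `T` independent trials with success
probability `p`. -/
def binomialTail (p : ℝ) : ℕ → ℕ → ℝ
  | _, 0 => 1
  | 0, _ + 1 => 0
  | T + 1, r + 1 => p * binomialTail p T r + (1 - p) * binomialTail p T (r + 1)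

section BinomialTail

variable {p : ℝ}

theorem binomialTail_zero_right (T : ℕ) : binomialTail p T 0 = 1 := by
  cases T <;> rfl

theorem binomialTail_nonneg (h0 : 0 ≤ p) (h1 : p ≤ 1) (T : ℕ) : ∀ r, 0 ≤ binomialTail p T r := by
  have h2 : 0 ≤ 1 - p := sub_nonneg.2 h1
  induction T with
  | zero => intro r; cases r <;> simp [binomialTail]
  | succ T ih =>
    intro r
    cases r with
    | zero => simp [binomialTail]
    | succ r =>
      have a := ih r
      have b := ih (r + 1)
      rw [binomialTail]
      positivity

theorem binomialTail_succ_le (h0 : 0 ≤ p) (h1 : p ≤ 1) (T : ℕ) :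
    ∀ r, binomialTail p T (r + 1) ≤ binomialTail p T r := by
  have h2 : 0 ≤ 1 - p := sub_nonneg.2 h1
  induction T with
  | zero => intro r; cases r <;> simp [binomialTail]
  | succ T ih =>
    intro r
    cases r with
    | zero =>
      have a := ih 0
      rw [binomialTail_zero_right] at a ⊢
      rw [binomialTail, binomialTail_zero_right]
      nlinarith
    | succ r =>
      have a := mul_le_mul_of_nonneg_left (ih r) h0
      have b := mul_le_mul_of_nonneg_left (ih (r + 1)) h2
      rw [binomialTail, binomialTail]
      linarith

theorem binomialTail_antitone (h0 : 0 ≤ p) (h1 : p ≤ 1) (T : ℕ) : Antitone (binomialTail p T) :=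
  antitone_nat_of_succ_le (binomialTail_succ_le h0 h1 T)

theorem binomialTail_monotone (h0 : 0 ≤ p) (h1 : p ≤ 1) (r : ℕ) :
    Monotone fun T => binomialTail p T r := by
  refine monotone_nat_of_le_succ fun T => ?_
  cases r with
  | zero => simp only [binomialTail_zero_right, le_refl]
  | succ r =>
    have a := mul_le_mul_of_nonneg_left (binomialTail_succ_le h0 h1 T r) h0
    change binomialTail p T (r + 1) ≤ p * binomialTail p T r + (1 - p) * binomialTail p T (r + 1)
    linarith

theorem binomialTail_one (T : ℕ) : binomialTail p T 1 = 1 - (1 - p) ^ T := by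
  induction T with
  | zero => simp [binomialTail]
  | succ T ih =>
    rw [binomialTail, ih, binomialTail_zero_right, pow_succ]
    ring

theorem binomialTail_mul_le (h0 : 0 ≤ p) (h1 : p ≤ 1) (S T r : ℕ) :
    binomialTail p S 1 * binomialTail p T r ≤ binomialTail p (S + T) (r + 1) := by
  have h2 : 0 ≤ 1 - p := sub_nonneg.2 h1
  induction S with
  | zero =>
    have := binomialTail_nonneg h0 h1 (0 + T) (r + 1)
    simpa [binomialTail] using this
  | succ S ih =>
    have e : S + 1 + T = (S + T) + 1 := by omega
    have hS : binomialTail p (S + 1) 1 = p * 1 + (1 - p) * binomialTail p S 1 := by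
      rw [binomialTail, binomialTail_zero_right]
    rw [e, hS, binomialTail]
    have a : binomialTail p T r ≤ binomialTail p (S + T) r :=
      binomialTail_monotone h0 h1 r (Nat.le_add_left T S)
    have b := mul_le_mul_of_nonneg_left a h0
    have c := mul_le_mul_of_nonneg_left ih h2
    linarith

theorem pow_le_binomialTail (h0 : 0 ≤ p) (h1 : p ≤ 1) (b r : ℕ) :
    (1 - (1 - p) ^ b) ^ r ≤ binomialTail p (r * b) r := by
  induction r with
  | zero => simp [binomialTail_zero_right]
  | succ r ih =>
    have h := binomialTail_mul_le h0 h1 b (r * b) r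
    rw [binomialTail_one] at h
    have h2 : 0 ≤ 1 - (1 - p) ^ b :=
      sub_nonneg.2 (pow_le_one₀ (sub_nonneg.2 h1) (by linarith))
    rw [pow_succ', show (r + 1) * b = b + r * b by ring]
    exact (mul_le_mul_of_nonneg_left ih h2).trans h

end BinomialTail

/-! ### Few sites -/

section FewSitesState

variable {k : ℕ} {ε : ℝ}

/-- A lower bound that only keeps the outcomes in which no last report is moved back. The factor
`(pm / p) ^ k` is the price of this in the rounds to come, where the transmission probability
drops from `p` to at least `pm`. -/
theorem le_expect_settle (hR : 0 < Real.sqrt k / ε) {s : State k} {i : Fin k}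
    (h : s.Consistent ε) (hp : State.Pending s i) (pm t : ℝ) {f : State k → ℝ≥0∞}
    (hf : ∀ s' : State k, s'.nbar = s.nbar → State.Settled ε s s' →
      ENNReal.ofReal ((pm / s'.p) ^ k * t) ≤ f s') :
    ENNReal.ofReal ((pm / s.p) ^ k * t) ≤ expect (s.settle ε i) f := by
  obtain ⟨s', h1, h2, h3⟩ := State.exists_le_settle hR h hp
  refine le_trans ?_ (apply_mul_le_expect _ f s')
  refine le_trans ?_ (mul_le_mul' h1 (hf s' h2 h3))
  have hs := s.p.2.1
  have hs' := s'.p.2.1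
  rw [← ENNReal.ofReal_mul (pow_nonneg (div_nonneg hs'.le hs.le) _), ← mul_assoc, ← mul_pow]
  refine le_of_eq ?_
  congr 3
  field_simp

open Classical in
/-- The number of reports after which the attack is certain to have visited `k` sites since move
`c₀`, as long as the transmission probability stays above `pm`. -/
def reportsNeeded (pm : ℝ) (c₀ : ℕ) (s : State k) (c : ℕ) : ℕ :=
  c₀ + k + 1 + Nat.log 2 ⌊(s.p : ℝ) / pm⌋₊ - (c + if s.published = s.sumEstimate then 1 else 0)

theorem reportsNeeded_settled {pm : ℝ} (hpm : 0 < pm) {s s' : State k}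
    (h : State.Settled ε s s') (hs' : pm ≤ s'.p) (c₀ c : ℕ) :
    reportsNeeded pm c₀ s' c ≤ reportsNeeded pm c₀ s c := by
  unfold reportsNeeded
  rcases h.p_le with ⟨h1, h2⟩ | h1
  · rw [h1, h2, h.published_eq]
  · have h2 : ⌊(s'.p : ℝ) / pm⌋₊ ≤ ⌊(s.p : ℝ) / pm⌋₊ / 2 := by
      rw [← Nat.floor_div_ofNat]
      apply Nat.floor_le_floor
      rw [div_right_comm]
      exact div_le_div_of_nonneg_right h1 hpm.le
    have h3 : 2 ≤ ⌊(s.p : ℝ) / pm⌋₊ := by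
      apply Nat.le_floor
      rw [le_div_iff₀ hpm]
      push_cast
      linarith
    have h4 := Nat.log_mono_right (b := 2) h2
    rw [Nat.log_div_base] at h4
    have h5 : 0 < Nat.log 2 ⌊(s.p : ℝ) / pm⌋₊ := Nat.log_pos one_lt_two h3
    split_ifs <;> omega

/-- The last reports of all sites together cover the events up to time `t₀`, and the published
estimate exceeds `t₀` by `B`. -/
structure Covered (t₀ : ℕ) (B : ℝ) (s : State k) : Prop where
  nbar_pos : ∀ j, 0 < s.nbar j
  le_sum_nbar : t₀ ≤ ∑ j, s.nbar j
  le_published : t₀ + B ≤ s.published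

theorem sumEstimate_of_nbar_pos {s : State k} (h : s.Consistent ε) (hs : ∀ j, 0 < s.nbar j) :
    s.sumEstimate = ((∑ j, s.nbar j : ℕ) : ℝ) + k * (1 / s.p - 1) := by
  unfold State.sumEstimate
  have : ∀ j ∈ Finset.univ, s.nhat j = (s.nbar j : ℝ) + (1 / s.p - 1) := by
    intro j _
    rw [h.nhat_eq, siteEstimate, if_neg (hs j).ne']
    ring
  rw [Finset.sum_congr rfl this, Finset.sum_add_distrib, Finset.sum_const, Finset.card_univ,
    Fintype.card_fin, nsmul_eq_mul]
  push_cast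
  rfl

theorem Covered.of_eq {t₀ : ℕ} {B : ℝ} {s s' : State k} (h : Covered t₀ B s)
    (hb : s'.nbar = s.nbar) (hp : s'.published = s.published) : Covered t₀ B s' :=
  ⟨by rw [hb]; exact h.nbar_pos, by rw [hb]; exact h.le_sum_nbar, by rw [hp]; exact h.le_published⟩

end FewSitesState

section FewSites

variable {k : ℕ} [NeZero k] {ε : ℝ}

/-- One event, under the restriction to the outcomes in which no last report is moved back. -/
theorem le_expect_step (hR : 0 < Real.sqrt k / ε) {x : State k × (ℕ × ℝ)} (hx : Synced ε x)
    {pm tT tF : ℝ} (hpm : 0 ≤ pm) (hT0 : 0 ≤ tT) (hF0 : 0 ≤ tF)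
    {f : State k × (ℕ × ℝ) → ℝ≥0∞}
    (hT : ∀ s' : State k, s'.nbar = (reported x).nbar → State.Settled ε (reported x) s' →
      ENNReal.ofReal ((pm / s'.p) ^ k * tT) ≤ f (s', move x.2 (reported x).published))
    (hF : ∀ s' : State k, s'.nbar = (silent x).nbar → State.Settled ε (silent x) s' →
      ENNReal.ofReal ((pm / s'.p) ^ k * tF) ≤ f (s', x.2)) :
    ENNReal.ofReal ((pm / x.1.p) ^ k * (x.1.p * tT + (1 - x.1.p) * tF)) ≤ expect (step ε x) f := by
  have hp0 : 0 ≤ (x.1.p : ℝ) := x.1.p.2.1.le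
  have hp1 : 0 ≤ 1 - (x.1.p : ℝ) := sub_nonneg.2 x.1.p.2.2
  have a := le_expect_settle (i := siteAt k x.2.1) hR (hx.valid.consistent_report _)
    (hx.valid.pending_report _) pm tT
    (f := fun s' => f (s', move x.2 (reported x).published)) hT
  have b := le_expect_settle (i := siteAt k x.2.1) hR (hx.valid.consistent_countEvent _)
    (hx.valid.pending_countEvent _) pm tF (f := fun s' => f (s', x.2)) hF
  rw [expect_step hR hx]
  refine le_trans (le_of_eq ?_) (add_le_add (mul_le_mul_right a _) (mul_le_mul_right b _))
  have e1 : (reported x).p = x.1.p := rfl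
  have e2 : (silent x).p = x.1.p := rfl
  rw [e1, e2, ← ENNReal.ofReal_mul hp0, ← ENNReal.ofReal_mul hp1,
    ← ENNReal.ofReal_add (by positivity) (by positivity)]
  congr 1
  ring

/-- All sites that the attack has left since move `c₀`, except possibly the current one, have
received an event and have no unreported events. -/
def LeftFresh (c₀ : ℕ) (x : State k × (ℕ × ℝ)) : Prop :=
  ∀ j, j ≠ siteAt k x.2.1 → (∃ c', c₀ ≤ c' ∧ c' < x.2.1 ∧ siteAt k c' = j) →
    x.1.nbar j = x.1.n j ∧ 0 < x.1.n j

theorem LeftFresh.of_reported {c₀ : ℕ} {x : State k × (ℕ × ℝ)} (h : LeftFresh c₀ x)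
    {s' : State k} (hb : s'.nbar = (reported x).nbar) (hn : s'.n = (reported x).n)
    {m : ℕ × ℝ} (hm : m.1 ≤ x.2.1 + 1) : LeftFresh c₀ (s', m) := by
  rintro j - ⟨c', h1, h2, h3⟩
  simp only at h2
  rw [hb, hn]
  by_cases hjx : j = siteAt k x.2.1
  · subst hjx
    simp [State.report, State.countEvent]
  · have hc : c' ≠ x.2.1 := by rintro rfl; exact hjx h3.symm
    have := h j hjx ⟨c', h1, by omega, h3⟩
    simpa [State.report, State.countEvent, hjx] using this

theorem LeftFresh.of_silent {c₀ : ℕ} {x : State k × (ℕ × ℝ)} (h : LeftFresh c₀ x)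
    {s' : State k} (hb : s'.nbar = (silent x).nbar) (hn : s'.n = (silent x).n) :
    LeftFresh c₀ (s', x.2) := by
  rintro j hj hc
  rw [hb, hn]
  have := h j hj hc
  have hj' : j ≠ siteAt k x.2.1 := hj
  simpa [State.countEvent, hj'] using this

theorem reportsNeeded_reported (pm : ℝ) (c₀ : ℕ) {x : State k × (ℕ × ℝ)} (hx : Synced ε x) :
    reportsNeeded pm c₀ (reported x) (move x.2 (reported x).published).1
      ≤ reportsNeeded pm c₀ x.1 x.2.1 - 1 := by
  unfold reportsNeeded
  rw [if_pos (State.published_report _ _)]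
  change c₀ + k + 1 + Nat.log 2 ⌊(x.1.p : ℝ) / pm⌋₊ - _ ≤ _
  by_cases h : x.1.published = x.1.sumEstimate
  · rw [if_pos h, move_of_ne (published_lt_of_report hx h).ne']
    omega
  · rw [if_neg h]
    have := le_fst_move x.2 (reported x).published
    omega

/-- At least `t₀` events have occurred, and all sites except possibly the current one have received
an event and have no unreported events. -/
def AllFresh (t₀ : ℕ) (x : State k × (ℕ × ℝ)) : Prop :=
  t₀ ≤ x.1.total ∧ ∀ j, j ≠ siteAt k x.2.1 → x.1.nbar j = x.1.n j ∧ 0 < x.1.n j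

theorem LeftFresh.allFresh {c₀ : ℕ} {x : State k × (ℕ × ℝ)} (h : LeftFresh c₀ x)
    (hc : c₀ + k ≤ x.2.1) : AllFresh x.1.total x := by
  refine ⟨le_rfl, fun j hj => h j hj ⟨c₀ + (j + k - c₀ % k) % k, by omega, ?_, ?_⟩⟩
  · have := Nat.mod_lt (j + k - c₀ % k) (Nat.pos_of_ne_zero (NeZero.ne k))
    omega
  · apply Fin.ext
    have h1 := Nat.mod_lt c₀ (Nat.pos_of_ne_zero (NeZero.ne k))
    change (c₀ + (j + k - c₀ % k) % k) % k = j
    rw [Nat.add_mod_mod, ← Nat.mod_add_mod, show c₀ % k + (j + k - c₀ % k) = j + k by omega,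
      Nat.add_mod_right, Nat.mod_eq_of_lt j.2]

open Classical in
/-- Except for a factor `(1 / 16) ^ k`, no last report is moved back in the rounds, and then `k + 5`
reports take the attack round all sites: at most five of them do not move the attack, one of them
for an adjustment before the `m` events and four for the at most four halvings of the transmission
probability. -/
theorem le_expect_stepN_allFresh (hR : 0 < Real.sqrt k / ε) {N : ℕ}
    (hN0 : 0 < N) (hN : Real.sqrt k / ε ≤ 2 * N) (m : ℕ) {x : State k × (ℕ × ℝ)}
    (hx : Synced ε x) (hxN : x.1.total + m ≤ N) (hNx : N ≤ 2 * x.1.total) :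
    ENNReal.ofReal ((1 / 16) ^ k * binomialTail (Real.sqrt k / ε / (2 * N)) m (k + 5))
      ≤ expect (stepN ε m x) fun y => if AllFresh (x.1.total + m) y then 1 else 0 := by
  set R := Real.sqrt k / ε with hRdef
  set pm := R / (2 * N) with hpm
  have hN' : (0 : ℝ) < N := by exact_mod_cast hN0
  have hpm0 : 0 < pm := by positivity
  have hpm1 : pm ≤ 1 := (div_le_one (by positivity)).2 hN
  have key := le_expect_stepN hR (T := x.1.total + m)
    (V := fun m' y => if LeftFresh x.2.1 y then ENNReal.ofReal
      ((pm / y.1.p) ^ k * binomialTail pm m' (reportsNeeded pm x.2.1 y.1 y.2.1)) else 0)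
    (f := fun y : State k × (ℕ × ℝ) => if AllFresh (x.1.total + m) y then 1 else 0)
    ?_ ?_ m x hx rfl
  · refine le_trans ?_ key
    rw [if_pos]
    · apply ENNReal.ofReal_le_ofReal
      have p2 : (x.1.p : ℝ) ≤ 16 * pm := by
        refine (hx.valid.p_le hR hN0 hNx).trans (le_of_eq ?_)
        rw [hpm]; field_simp; ring
      have hp0 := x.1.p.2.1
      apply mul_le_mul
      · apply pow_le_pow_left₀ (by norm_num)
        rw [le_div_iff₀ hp0]
        linarith
      · apply binomialTail_antitone hpm0.le hpm1
        unfold reportsNeeded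
        have h1 : Nat.log 2 ⌊(x.1.p : ℝ) / pm⌋₊ ≤ Nat.log 2 16 := by
          apply Nat.log_mono_right
          apply Nat.floor_le_of_le
          rw [div_le_iff₀ hpm0]
          exact_mod_cast p2
        have h2 : Nat.log 2 16 = 4 := by
          rw [show 16 = 2 ^ 4 by norm_num, Nat.log_pow one_lt_two]
        omega
      · exact binomialTail_nonneg hpm0.le hpm1 _ _
      · positivity
    · rintro j - ⟨c', h1, h2, -⟩
      omega
  · intro y hy hyT
    split_ifs with h1 h2 h2
    · rw [← ENNReal.ofReal_one]
      apply ENNReal.ofReal_le_ofReal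
      have p1 : pm ≤ y.1.p := hy.valid.le_p hR hN0 hN (by omega)
      have hp0 := y.1.p.2.1
      refine mul_le_one₀ (pow_le_one₀ (by positivity) ((div_le_one hp0).2 p1))
        (binomialTail_nonneg hpm0.le hpm1 _ _) ?_
      calc _ ≤ binomialTail pm 0 0 := binomialTail_antitone hpm0.le hpm1 0 (Nat.zero_le _)
        _ = 1 := binomialTail_zero_right _
    · have h3 : reportsNeeded pm x.2.1 y.1 y.2.1 ≠ 0 := by
        intro h4
        apply h2
        rw [← hyT]
        apply h1.allFresh
        unfold reportsNeeded at h4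
        split_ifs at h4 <;> omega
      obtain ⟨r, hr⟩ := Nat.exists_eq_succ_of_ne_zero h3
      rw [hr]
      simp [binomialTail]
    · exact zero_le
    · exact zero_le
  · intro m' y hy hyT
    split_ifs with h1
    swap
    · exact zero_le
    have p1 : pm ≤ y.1.p := hy.valid.le_p hR hN0 hN (by omega)
    have hp1 := y.1.p.2.2
    set r := reportsNeeded pm x.2.1 y.1 y.2.1 with hr
    have t1 := binomialTail_nonneg hpm0.le hpm1 m' (r - 1)
    have t2 := binomialTail_nonneg hpm0.le hpm1 m' r
    refine le_trans (ENNReal.ofReal_le_ofReal ?_)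
      (le_expect_step hR hy hpm0.le t1 t2 ?_ ?_)
    · apply mul_le_mul_of_nonneg_left _ (pow_nonneg (div_nonneg hpm0.le y.1.p.2.1.le) _)
      rcases Nat.eq_zero_or_pos r with h0 | h0
      · rw [h0]
        simp only [binomialTail_zero_right, Nat.zero_sub]
        linarith
      · obtain ⟨r', hr'⟩ := Nat.exists_eq_succ_of_ne_zero h0.ne'
        rw [hr'] at t1 t2 ⊢
        rw [Nat.succ_sub_one] at t1 ⊢
        have h2 := binomialTail_succ_le hpm0.le hpm1 m' r'
        rw [Nat.succ_eq_add_one, binomialTail]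
        nlinarith
    · intro s' hb hS
      have p2 : pm ≤ s'.p := hS.valid.le_p hR hN0 hN (by
        rw [hS.total_eq, total_reported]; omega)
      rw [if_pos (h1.of_reported hb hS.n_eq (fst_move_le _ _))]
      apply ENNReal.ofReal_le_ofReal
      apply mul_le_mul_of_nonneg_left _ (pow_nonneg (div_nonneg hpm0.le s'.p.2.1.le) _)
      apply binomialTail_antitone hpm0.le hpm1
      exact (reportsNeeded_settled hpm0 hS p2 _ _).trans (reportsNeeded_reported pm _ hy)
    · intro s' hb hS
      have p2 : pm ≤ s'.p := hS.valid.le_p hR hN0 hN (by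
        rw [hS.total_eq, total_silent]; omega)
      rw [if_pos (h1.of_silent hb hS.n_eq)]
      apply ENNReal.ofReal_le_ofReal
      apply mul_le_mul_of_nonneg_left _ (pow_nonneg (div_nonneg hpm0.le s'.p.2.1.le) _)
      apply binomialTail_antitone hpm0.le hpm1
      exact reportsNeeded_settled hpm0 hS p2 x.2.1 y.2.1

theorem AllFresh.of_reported {t₀ : ℕ} {x : State k × (ℕ × ℝ)} (h : AllFresh t₀ x)
    {s' : State k} (hb : s'.nbar = (reported x).nbar) (hS : State.Settled ε (reported x) s')
    {m : ℕ × ℝ} : AllFresh t₀ (s', m) := by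
  refine ⟨?_, fun j _ => ?_⟩
  · change t₀ ≤ s'.total
    rw [hS.total_eq, total_reported]
    exact h.1.trans (Nat.le_succ _)
  · change s'.nbar j = s'.n j ∧ 0 < s'.n j
    rw [hb, hS.n_eq]
    by_cases hjx : j = siteAt k x.2.1
    · subst hjx
      simp [State.report, State.countEvent]
    · have := h.2 j hjx
      simpa [State.report, State.countEvent, hjx] using this

theorem AllFresh.of_silent {t₀ : ℕ} {x : State k × (ℕ × ℝ)} (h : AllFresh t₀ x)
    {s' : State k} (hb : s'.nbar = (silent x).nbar) (hS : State.Settled ε (silent x) s') :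
    AllFresh t₀ (s', x.2) := by
  refine ⟨?_, fun j hj => ?_⟩
  · change t₀ ≤ s'.total
    rw [hS.total_eq, total_silent]
    exact h.1.trans (Nat.le_succ _)
  · change s'.nbar j = s'.n j ∧ 0 < s'.n j
    rw [hb, hS.n_eq]
    have hjx : j ≠ siteAt k x.2.1 := hj
    have := h.2 j hj
    simpa [State.countEvent, hjx] using this

/-- A report at the only site with unreported events covers all events. -/
theorem AllFresh.covered {t₀ : ℕ} {B : ℝ} {x : State k × (ℕ × ℝ)} (h : AllFresh t₀ x)
    (hx : Synced ε x) (hB : B ≤ k * (1 / x.1.p - 1)) {s' : State k}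
    (hb : s'.nbar = (reported x).nbar) (hS : State.Settled ε (reported x) s') :
    Covered t₀ B s' := by
  have h1 : ∀ j, (reported x).nbar j = (reported x).n j ∧ 0 < (reported x).n j := by
    intro j
    by_cases hjx : j = siteAt k x.2.1
    · subst hjx
      simp [State.report, State.countEvent]
    · have := h.2 j hjx
      simpa [State.report, State.countEvent, hjx] using this
  have h2 : ∀ j, 0 < (reported x).nbar j := fun j => by rw [(h1 j).1]; exact (h1 j).2
  have h3 : t₀ ≤ ∑ j, (reported x).nbar j := by
    rw [Finset.sum_congr rfl fun j _ => (h1 j).1]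
    change t₀ ≤ (reported x).total
    rw [total_reported]
    exact h.1.trans (Nat.le_succ _)
  refine ⟨by rw [hb]; exact h2, by rw [hb]; exact h3, ?_⟩
  rw [hS.published_eq, State.published_report,
    sumEstimate_of_nbar_pos (hx.valid.consistent_report _) h2]
  have h4 : (t₀ : ℝ) ≤ ((∑ j, (reported x).nbar j : ℕ) : ℝ) := by exact_mod_cast h3
  change t₀ + B ≤ _ + k * (1 / (x.1.p : ℝ) - 1)
  linarith

open Classical in
/-- One report at the current site, the only one with unreported events, suffices; after it, the
events covered by the last reports stay covered as long as no last report is moved back. -/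
theorem le_expect_stepN_covered (hR : 0 < Real.sqrt k / ε) {N : ℕ}
    (hN0 : 0 < N) (hN : Real.sqrt k / ε ≤ 2 * N) (m : ℕ) {x : State k × (ℕ × ℝ)}
    (hx : Synced ε x) (hxN : x.1.total + m ≤ N) (hNx : N ≤ 2 * x.1.total)
    (hfresh : AllFresh x.1.total x) :
    ENNReal.ofReal ((1 / 16) ^ k * (1 - (1 - Real.sqrt k / ε / (2 * N)) ^ m))
      ≤ expect (stepN ε m x) fun y =>
        if Covered x.1.total (k * (1 / (16 * (Real.sqrt k / ε / (2 * N))) - 1)) y.1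
          then 1 else 0 := by
  set R := Real.sqrt k / ε with hRdef
  set pm := R / (2 * N) with hpm
  have hN' : (0 : ℝ) < N := by exact_mod_cast hN0
  have hpm0 : 0 < pm := by positivity
  have hpm1 : pm ≤ 1 := (div_le_one (by positivity)).2 hN
  set B := (k : ℝ) * (1 / (16 * pm) - 1) with hB
  set t₀ := x.1.total with ht₀
  have hq : ∀ m' : ℕ, 0 ≤ 1 - (1 - pm) ^ m' ∧ 1 - (1 - pm) ^ m' ≤ 1 := fun m' =>
    ⟨sub_nonneg.2 (pow_le_one₀ (by linarith) (by linarith)),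
      sub_le_self _ (pow_nonneg (by linarith) _)⟩
  have hp16 : ∀ y : State k × (ℕ × ℝ), Synced ε y → t₀ ≤ y.1.total → (y.1.p : ℝ) ≤ 16 * pm := by
    intro y hy h
    refine (hy.valid.p_le hR hN0 (by omega)).trans (le_of_eq ?_)
    rw [hpm]; field_simp; ring
  have key := le_expect_stepN hR (T := t₀ + m)
    (V := fun m' y => if AllFresh t₀ y then ENNReal.ofReal
      ((pm / y.1.p) ^ k * if Covered t₀ B y.1 then 1 else 1 - (1 - pm) ^ m') else 0)
    (f := fun y : State k × (ℕ × ℝ) => if Covered t₀ B y.1 then 1 else 0)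
    ?_ ?_ m x hx rfl
  · refine le_trans ?_ key
    rw [if_pos hfresh]
    apply ENNReal.ofReal_le_ofReal
    have p2 := hp16 x hx le_rfl
    have hp0 := x.1.p.2.1
    apply mul_le_mul
    · apply pow_le_pow_left₀ (by norm_num)
      rw [le_div_iff₀ hp0]
      linarith
    · split_ifs
      · exact (hq m).2
      · exact le_rfl
    · exact (hq m).1
    · positivity
  · intro y hy hyT
    split_ifs with h1 h2 h2
    · rw [← ENNReal.ofReal_one, mul_one]
      apply ENNReal.ofReal_le_ofReal
      have p1 : pm ≤ y.1.p := hy.valid.le_p hR hN0 hN (by omega)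
      have hp0 := y.1.p.2.1
      exact pow_le_one₀ (by positivity) ((div_le_one hp0).2 p1)
    · simp
    · exact zero_le
    · exact zero_le
  · intro m' y hy hyT
    by_cases h1 : AllFresh t₀ y
    swap
    · rw [if_neg h1]
      exact zero_le
    rw [if_pos h1]
    have p1 : pm ≤ y.1.p := hy.valid.le_p hR hN0 hN (by omega)
    have hp1 := y.1.p.2.2
    set t := (if Covered t₀ B y.1 then 1 else 1 - (1 - pm) ^ m' : ℝ) with ht
    have t1 : 0 ≤ t := by
      rw [ht]; split_ifs
      · norm_num
      · exact (hq m').1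
    refine le_trans (ENNReal.ofReal_le_ofReal ?_)
      (le_expect_step hR hy hpm0.le zero_le_one t1 ?_ ?_)
    · apply mul_le_mul_of_nonneg_left _ (pow_nonneg (div_nonneg hpm0.le y.1.p.2.1.le) _)
      rw [ht]
      split_ifs
      · linarith
      · have h2 : 0 ≤ (1 - pm) ^ m' := pow_nonneg (by linarith) _
        rw [pow_succ]
        nlinarith
    · intro s' hb hS
      rw [if_pos (h1.of_reported hb hS), if_pos]
      refine h1.covered hy ?_ hb hS
      rw [hB]
      have h2 := one_div_le_one_div_of_le y.1.p.2.1 (hp16 y hy h1.1)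
      gcongr
    · intro s' hb hS
      rw [if_pos (h1.of_silent hb hS)]
      apply ENNReal.ofReal_le_ofReal
      apply mul_le_mul_of_nonneg_left _ (pow_nonneg (div_nonneg hpm0.le s'.p.2.1.le) _)
      rw [ht]
      by_cases h2 : Covered t₀ B y.1
      · have h3 : Covered t₀ B s' := h2.of_eq hb hS.published_eq
        simp only [if_pos h2, if_pos h3, le_refl]
      · rw [if_neg h2]
        split_ifs
        · exact (hq m').2
        · exact le_rfl

/-- A probability of a large error that is bounded below for each number of sites. -/
theorem le_expect_large_error (hR : (k : ℝ) ≤ Real.sqrt k / ε) {n : ℕ}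
    (hn : 64 * (Real.sqrt k / ε) < n) {est : State k → ℝ}
    (hest : est = State.published ∨ est = State.sumEstimate) :
    ENNReal.ofReal ((1 / 256) ^ k * (1 - Real.exp (-(1 / 128))) ^ (k + 6))
      ≤ expect (countedRun k ε n) fun y =>
        if n / (32 * (Real.sqrt k / ε)) ≤ est y.1 - n then 1 else 0 := by
  classical
  have hk0 : 0 < k := Nat.pos_of_ne_zero (NeZero.ne k)
  have hk1 : (1 : ℝ) ≤ k := by exact_mod_cast hk0
  set R := Real.sqrt k / ε with hRdef
  have hR1 : 1 ≤ R := by linarith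
  have hR0 : 0 < R := by linarith
  have hn' : (0 : ℝ) < n := by linarith
  have hn0 : 0 < n := by exact_mod_cast hn'
  have hn64 : 64 < n := by
    have : (64 : ℝ) < n := by linarith
    exact_mod_cast this
  set pm := R / (2 * n) with hpm
  have hpm0 : 0 < pm := by positivity
  have hpmn : pm * n = R / 2 := by rw [hpm]; field_simp
  have hN : R ≤ 2 * n := by linarith
  have hpm128 : pm ≤ 1 / 128 := by
    rw [hpm, div_le_div_iff₀ (by positivity) (by norm_num)]; linarith
  have hpm1 : pm ≤ 1 := by linarith
  have hinv : n / (32 * R) = 1 / (64 * pm) := by rw [hpm]; field_simp; norm_num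
  have hinv2 : 2 ≤ 1 / (64 * pm) := by
    rw [le_div_iff₀ (by positivity)]; linarith
  -- the numbers of events in the last two phases
  set w := ⌊1 / (64 * pm)⌋₊ with hw
  have hw1 : (w : ℝ) ≤ 1 / (64 * pm) := Nat.floor_le (by positivity)
  have hw2 : 1 / (64 * pm) < w + 1 := Nat.lt_floor_add_one _
  have hwn : 32 * w ≤ n := by
    have h1 : (w : ℝ) ≤ n / 32 := by
      rw [← hinv] at hw1
      refine hw1.trans ?_
      apply div_le_div_of_nonneg_left hn'.le (by norm_num) (by linarith)
    have : (32 : ℝ) * w ≤ n := by linarith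
    exact_mod_cast this
  set m := n / 4 with hm
  have hm5 : (n : ℝ) / 5 ≤ m := by
    have : n ≤ 5 * m := by omega
    have : (n : ℝ) ≤ 5 * m := by exact_mod_cast this
    linarith
  set u := n - m - w with hu
  have hnum : n = u + m + w := by omega
  have hu2 : n ≤ 2 * u := by omega
  set κ := 1 - Real.exp (-(1 / 128)) with hκ
  have hκ0 : 0 ≤ κ := sub_nonneg.2 (Real.exp_le_one_iff.2 (by norm_num))
  have hκb : ∀ b : ℕ, 1 / 128 ≤ pm * b → κ ≤ 1 - (1 - pm) ^ b := by
    intro b hb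
    have : (1 - pm) ^ b ≤ Real.exp (-(1 / 128)) := by
      calc (1 - pm) ^ b ≤ Real.exp (-pm) ^ b :=
            pow_le_pow_left₀ (by linarith) (Real.one_sub_le_exp_neg _) b
        _ = Real.exp (-(pm * b)) := by rw [← Real.exp_nat_mul]; congr 1; ring
        _ ≤ _ := Real.exp_le_exp.2 (by linarith)
    linarith
  have hw3 : κ ≤ 1 - (1 - pm) ^ w := by
    apply hκb
    have h1 : 1 / (128 * pm) ≤ w := by
      have : 1 / (64 * pm) = 2 * (1 / (128 * pm)) := by field_simp; norm_num
      linarith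
    calc (1 : ℝ) / 128 = pm * (1 / (128 * pm)) := by field_simp
      _ ≤ _ := by gcongr
  have hm3 : κ ^ (k + 5) ≤ binomialTail pm m (k + 5) := by
    set b := m / (k + 5) with hb
    have h1 : κ ≤ 1 - (1 - pm) ^ b := by
      apply hκb
      have h2 : m < (k + 5) * (b + 1) := by
        rw [mul_comm]; exact Nat.lt_mul_of_div_lt (Nat.lt_succ_self _) (by omega)
      have h3 : (m : ℝ) < (k + 5) * (b + 1) := by exact_mod_cast h2
      have h4 : pm * (n / 5) ≤ pm * ((k + 5) * (b + 1)) := by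
        gcongr; linarith
      have h5 : pm * (n / 5) = R / 10 := by
        rw [mul_div_assoc', hpmn]; ring
      have h6 : R / 10 ≤ 6 * R * (pm * (b + 1)) := by
        rw [← h5]
        refine h4.trans ?_
        have h7 : (k : ℝ) + 5 ≤ 6 * R := by linarith
        calc pm * ((k + 5) * (b + 1)) = (k + 5) * (pm * (b + 1)) := by ring
          _ ≤ _ := by gcongr
      have h8 : 1 / 60 ≤ pm * (b + 1) := by
        by_contra hc
        push Not at hc
        have := mul_lt_mul_of_pos_left hc (show 0 < 6 * R by positivity)
        linarith
      linarith
    calc κ ^ (k + 5) ≤ (1 - (1 - pm) ^ b) ^ (k + 5) := pow_le_pow_left₀ hκ0 h1 _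
      _ ≤ binomialTail pm ((k + 5) * b) (k + 5) := pow_le_binomialTail hpm0.le hpm1 b _
      _ ≤ _ := binomialTail_monotone hpm0.le hpm1 _ (Nat.mul_div_le _ _)
  set B := (k : ℝ) * (1 / (16 * pm) - 1) with hB
  have hgood : ∀ y : State k × (ℕ × ℝ), Synced ε y → y.1.total = n → Covered (u + m) B y.1 →
      n / (32 * R) ≤ est y.1 - n := by
    intro y hy hyt hc
    have h1 : ((u + m : ℕ) : ℝ) + B ≤ est y.1 := by
      rcases hest with rfl | rfl
      · exact hc.le_published
      · rw [sumEstimate_of_nbar_pos hy.valid.toConsistent hc.nbar_pos]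
        have h2 : ((u + m : ℕ) : ℝ) ≤ ((∑ j, y.1.nbar j : ℕ) : ℝ) := by
          exact_mod_cast hc.le_sum_nbar
        have h3 : (y.1.p : ℝ) ≤ 16 * pm := by
          refine (hy.valid.p_le hR0 hn0 (by omega)).trans (le_of_eq ?_)
          rw [hpm]; field_simp; ring
        have h4 := one_div_le_one_div_of_le y.1.p.2.1 h3
        have h5 : B ≤ k * (1 / (y.1.p : ℝ) - 1) := by rw [hB]; gcongr
        linarith
    have h2 : (n : ℝ) = ((u + m : ℕ) : ℝ) + w := by exact_mod_cast hnum
    have h3 : 1 / (16 * pm) = 4 * (1 / (64 * pm)) := by field_simp; norm_num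
    have h4 : 1 / (16 * pm) - 1 ≤ B := by
      rw [hB]
      exact le_mul_of_one_le_left (by linarith) hk1
    rw [hinv]
    linarith
  rw [show countedRun k ε n = ((countedRun k ε u).bind (stepN ε m)).bind (stepN ε w) by
    rw [← countedRun_add, ← countedRun_add, ← hnum], expect_bind, expect_bind]
  refine le_trans (expect_const (countedRun k ε u) _).ge (expect_mono fun x hx => ?_)
  obtain ⟨hx1, hx2⟩ := synced_of_mem_support_countedRun hR1 u x hx
  have hA := le_expect_stepN_allFresh hR0 hn0 hN m hx1 (by omega) (by omega)
  have hstep : ∀ z ∈ (stepN ε m x).support,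
      ENNReal.ofReal ((1 / 16) ^ k * (1 - (1 - pm) ^ w))
          * (if AllFresh (x.1.total + m) z then 1 else 0)
        ≤ expect (stepN ε w z) fun y => if n / (32 * R) ≤ est y.1 - n then 1 else 0 := by
    intro z hz
    obtain ⟨hz1, hz2⟩ := synced_of_mem_support_stepN hR0 m x hx1 z hz
    split_ifs with h
    · rw [← hz2] at h
      rw [mul_one]
      refine (le_expect_stepN_covered hR0 hn0 hN w hz1 (by omega) (by omega) h).trans
        (expect_mono fun y hy => ?_)
      obtain ⟨hy1, hy2⟩ := synced_of_mem_support_stepN hR0 w z hz1 y hy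
      by_cases hc : Covered z.1.total (k * (1 / (16 * (R / (2 * n))) - 1)) y.1
      · rw [if_pos hc, if_pos]
        refine hgood y hy1 (by omega) ?_
        rw [hz2, hx2] at hc
        exact hc
      · rw [if_neg hc]
        exact zero_le
    · rw [mul_zero]
      exact zero_le
  refine le_trans ?_ (expect_mono hstep)
  rw [expect_const_mul]
  refine le_trans ?_ (mul_le_mul_right hA _)
  have hw4 : 0 ≤ 1 - (1 - pm) ^ w := hκ0.trans hw3
  rw [← ENNReal.ofReal_mul (by positivity)]
  apply ENNReal.ofReal_le_ofReal
  calc (1 / 256 : ℝ) ^ k * κ ^ (k + 6) = (1 / 16) ^ k * κ * ((1 / 16) ^ k * κ ^ (k + 5)) := by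
        rw [show (1 / 256 : ℝ) = 1 / 16 * (1 / 16) by norm_num, mul_pow]; ring
    _ ≤ _ := by gcongr

end FewSites

/-! ### Conclusion -/

section Conclusion

variable {k : ℕ} [NeZero k] {ε : ℝ}

open Classical in
theorem toOuterMeasure_run_eq_expect (n : ℕ) (est : State k → ℝ) (b : ℝ) :
    (run ε (roundRobinAttack k) n).toOuterMeasure {x | b < est x.1 - n}
      = expect (countedRun k ε n) fun y => if b < est y.1 - n then 1 else 0 := by
  have h : ∀ μ : PMF (State k × (Fin k × ℝ)),
      μ = ((countedRun k ε n).map fun x => (x.1, (siteAt k x.2.1, x.2.2))) →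
      μ.toOuterMeasure {x | b < est x.1 - n}
        = expect (countedRun k ε n) fun y => if b < est y.1 - n then 1 else 0 := by
    rintro μ rfl
    rw [toOuterMeasure_eq_expect, expect_map]
    refine expect_congr fun y _ => ?_
    simp only [Set.indicator_apply, Set.mem_ofPred_eq, Pi.one_apply]
  exact h _ (run_roundRobinAttack ε n)

theorem expect_le_one {α : Type*} (μ : PMF α) {f : α → ℝ≥0∞} (hf : ∀ x, f x ≤ 1) :
    expect μ f ≤ 1 :=
  (expect_mono (g := fun _ => 1) fun x _ => hf x).trans (expect_const μ 1).le

theorem le_toReal_of_expect_le {α : Type*} (μ : PMF α) {f g : α → ℝ≥0∞} (hf : ∀ x, f x ≤ 1)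
    (hfg : ∀ x, 1 ≤ f x + g x) {b : ℝ} (hb : 0 ≤ b) (hg : expect μ g ≤ ENNReal.ofReal b) :
    1 - b ≤ (expect μ f).toReal := by
  have h1 : 1 ≤ expect μ f + ENNReal.ofReal b := by
    refine le_trans ?_ (add_le_add_right hg _)
    rw [← expect_add, ← expect_const μ 1]
    exact expect_mono fun x _ => hfg x
  have hfin : expect μ f ≠ ⊤ := ((expect_le_one μ hf).trans_lt ENNReal.one_lt_top).ne
  have h2 := ENNReal.toReal_mono (ENNReal.add_ne_top.2 ⟨hfin, ENNReal.ofReal_ne_top⟩) h1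
  rw [ENNReal.toReal_one, ENNReal.toReal_add hfin ENNReal.ofReal_ne_top,
    ENNReal.toReal_ofReal hb] at h2
  linarith

/-- The prefactors of the bound for many sites are absorbed into the exponential. -/
theorem prefactor_bound {a x : ℝ} (ha : 0 < a) (ha1 : a ≤ 1 / 40) (hx : 648 / a ^ 2 ≤ x)
    (hx1 : 1 ≤ x) :
    16 * Real.exp (-(x / 40)) + 65 * x * Real.exp (-(a * x)) ≤ Real.exp (-(a / 2) * x) := by
  have h1 : Real.exp (-(x / 40)) ≤ Real.exp (-(a * x)) := by
    apply Real.exp_le_exp.2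
    nlinarith
  have h2 : 81 * x ≤ Real.exp (a / 2 * x) := by
    have h3 := Real.quadratic_le_exp_of_nonneg (show 0 ≤ a / 2 * x by positivity)
    have h4 : 648 ≤ x * a ^ 2 := (div_le_iff₀ (by positivity)).1 hx
    have h5 : 81 * x ≤ (a / 2 * x) ^ 2 / 2 := by nlinarith
    have h6 : 0 ≤ a / 2 * x := by positivity
    linarith
  have h7 : Real.exp (-(a / 2) * x) = Real.exp (a / 2 * x) * Real.exp (-(a * x)) := by
    rw [← Real.exp_add]; congr 1; ring
  rw [h7]
  have h8 := Real.exp_pos (-(a * x))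
  have h9 := mul_le_mul_of_nonneg_right h2 h8.le
  nlinarith

/-- Both bounds together, for either estimate of the total count. -/
theorem le_toReal_large_error {c₁ c₂ : ℝ} {K : ℕ} (hK : 160 ≤ K)
    (hKa : 648 / (1 / (2 ^ 14 * 10000) : ℝ) ^ 2 ≤ K)
    (hc₁ : c₁ ≤ 1 / 2 ^ 14) (hc₁K : c₁ * K < 1 / 32)
    (hc₂0 : 0 ≤ c₂) (hc₂ : c₂ ≤ 1 / (2 ^ 14 * 10000) / 2)
    (hc₂K : 1 - Real.exp (-(c₂ * K)) ≤ (1 / 256) ^ K * (1 - Real.exp (-(1 / 128))) ^ (K + 6))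
    (hε : 0 < ε) (hεk : ε ≤ 1 / Real.sqrt k) {n : ℕ} (hn : 64 * Real.sqrt k / ε < n)
    {est : State k → ℝ} (hest : est = State.published ∨ est = State.sumEstimate) :
    1 - Real.exp (-c₂ * k) ≤ ((run ε (roundRobinAttack k) n).toOuterMeasure
      {x | c₁ * Real.sqrt k * ε * n < est x.1 - n}).toReal := by
  classical
  have hk0 : 0 < k := Nat.pos_of_ne_zero (NeZero.ne k)
  have hk1 : (1 : ℝ) ≤ k := by exact_mod_cast hk0
  have hsq : 0 < Real.sqrt k := Real.sqrt_pos.2 (by linarith)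
  have hsq2 : Real.sqrt k * Real.sqrt k = k := Real.mul_self_sqrt (by linarith)
  have hR : (k : ℝ) ≤ Real.sqrt k / ε := by
    rw [le_div_iff₀ hε]
    calc (k : ℝ) * ε ≤ k * (1 / Real.sqrt k) := by gcongr
      _ = Real.sqrt k := by
        rw [mul_one_div, div_eq_iff hsq.ne', hsq2]
  have hR0 : 0 < Real.sqrt k / ε := by positivity
  have hn' : 64 * (Real.sqrt k / ε) < n := by rwa [← mul_div_assoc]
  have hn0 : (0 : ℝ) < n := by linarith
  have htarget : c₁ * Real.sqrt k * ε * n = c₁ * k * n / (Real.sqrt k / ε) := by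
    rw [eq_div_iff hR0.ne']
    calc c₁ * Real.sqrt k * ε * n * (Real.sqrt k / ε)
        = c₁ * (Real.sqrt k * Real.sqrt k) * n * (ε / ε) := by ring
      _ = c₁ * k * n := by rw [hsq2, div_self hε.ne', mul_one]
  rw [toOuterMeasure_run_eq_expect, htarget]
  rcases le_total K k with hKk | hkK
  · have hKk' : (K : ℝ) ≤ k := by exact_mod_cast hKk
    have hN : Real.sqrt k / ε ≤ 2 * n := by linarith
    have hl : 0 ≤ Real.sqrt k / ε / (2 * n) / 2 ^ 14 := by positivity
    have hest' : IsEstimator ε (Real.sqrt k / ε / (2 * n) / 2 ^ 14) n est := by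
      rcases hest with rfl | rfl
      · exact isEstimator_published hR0 hl n
      · exact isEstimator_sumEstimate hR0 hl hN (by gcongr; norm_num)
    have h := expect_small_error_le (hK.trans hKk) hR hn' hest'
    have hpre := prefactor_bound (a := 1 / (2 ^ 14 * 10000)) (by norm_num) (by norm_num)
      (hKa.trans hKk') hk1
    have h2 := le_toReal_of_expect_le (countedRun k ε n)
      (f := fun y => if c₁ * k * n / (Real.sqrt k / ε) < est y.1 - n then 1 else 0) ?_ ?_ ?_ h
    · refine le_trans ?_ h2
      have e1 : (k : ℝ) / (2 ^ 14 * 10000) = 1 / (2 ^ 14 * 10000) * k := by ring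
      have e2 : Real.exp (-(1 / (2 ^ 14 * 10000) / 2) * (k : ℝ)) ≤ Real.exp (-c₂ * k) := by
        apply Real.exp_le_exp.2
        gcongr
      rw [e1]
      linarith
    · intro y
      split_ifs
      · exact le_rfl
      · exact zero_le
    · intro y
      by_cases a : c₁ * k * n / (Real.sqrt k / ε) < est y.1 - n
      · rw [if_pos a]
        exact le_self_add
      · rw [if_neg a, if_pos ((not_lt.1 a).trans (by gcongr)), zero_add]
    · positivity
  · have h := le_expect_large_error hR hn' hest
    have hkK' : (k : ℝ) ≤ K := by exact_mod_cast hkK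
    set κ := 1 - Real.exp (-(1 / 128) : ℝ) with hκ
    have hκ0 : 0 ≤ κ := sub_nonneg.2 (Real.exp_le_one_iff.2 (by norm_num))
    have hκ1 : κ ≤ 1 := sub_le_self _ (Real.exp_pos _).le
    have h2 : expect (countedRun k ε n) (fun y : State k × (ℕ × ℝ) =>
          if n / (32 * (Real.sqrt k / ε)) ≤ est y.1 - n then (1 : ℝ≥0∞) else 0)
        ≤ expect (countedRun k ε n)
          fun y => if c₁ * k * n / (Real.sqrt k / ε) < est y.1 - n then 1 else 0 := by
      refine expect_mono fun y _ => ?_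
      by_cases hy : n / (32 * (Real.sqrt k / ε)) ≤ est y.1 - n
      · rw [if_pos hy, if_pos]
        refine lt_of_lt_of_le ?_ hy
        rw [← div_div, div_lt_div_iff_of_pos_right hR0]
        have h3 : c₁ * k < 1 / 32 := by
          rcases le_total c₁ 0 with h0 | h0
          · have := mul_nonpos_of_nonpos_of_nonneg h0 (show (0 : ℝ) ≤ k by linarith)
            linarith
          · exact (mul_le_mul_of_nonneg_left hkK' h0).trans_lt hc₁K
        have := mul_lt_mul_of_pos_right h3 hn0
        linarith
      · rw [if_neg hy]
        exact zero_le
    have hfin : expect (countedRun k ε n)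
        (fun y => if c₁ * k * n / (Real.sqrt k / ε) < est y.1 - n then (1 : ℝ≥0∞) else 0) ≠ ⊤ := by
      refine ((expect_le_one _ fun y => ?_).trans_lt ENNReal.one_lt_top).ne
      split_ifs
      · exact le_rfl
      · exact zero_le
    have h3 := (ENNReal.ofReal_le_iff_le_toReal hfin).1 (h.trans h2)
    refine le_trans ?_ h3
    have h4 : 1 - Real.exp (-c₂ * k) ≤ 1 - Real.exp (-(c₂ * K)) := by
      apply sub_le_sub_left
      apply Real.exp_le_exp.2
      have := mul_le_mul_of_nonneg_left hkK' hc₂0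
      linarith
    refine h4.trans (hc₂K.trans ?_)
    apply mul_le_mul
    · exact pow_le_pow_of_le_one (by norm_num) (by norm_num) hkK
    · exact pow_le_pow_of_le_one hκ0 hκ1 (by omega)
    · positivity
    · positivity

end Conclusion

end DistributedCounting

end

theorem theorem2p1 :
    ∃ c₁ c₂ c₃ : ℝ, 0 < c₁ ∧ 0 < c₂ ∧ 0 < c₃ ∧
      ∀ (k : ℕ) [NeZero k] (ε : ℝ), 0 < ε → ε ≤ 1 / Real.sqrt k →
        ∀ n : ℕ, c₃ * Real.sqrt k / ε < n →
          1 - Real.exp (-c₂ * k) ≤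
              ((DistributedCounting.run ε (DistributedCounting.roundRobinAttack k) n).toOuterMeasure
                {x | c₁ * Real.sqrt k * ε * n < x.1.published - n}).toReal ∧
            1 - Real.exp (-c₂ * k) ≤
              ((DistributedCounting.run ε (DistributedCounting.roundRobinAttack k) n).toOuterMeasure
                {x | c₁ * Real.sqrt k * ε * n < x.1.sumEstimate - n}).toReal := by
  -- more than `K` sites are many; the constants are then adapted to fewer sites
  obtain ⟨K, hK⟩ := exists_nat_ge (max 160 (648 / (1 / (2 ^ 14 * 10000) : ℝ) ^ 2))
  have hK160 : (160 : ℝ) ≤ K := (le_max_left _ _).trans hK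
  have hKa := (le_max_right _ _).trans hK
  have hK0 : (0 : ℝ) < K := by linarith
  set δ : ℝ := (1 / 256) ^ K * (1 - Real.exp (-(1 / 128))) ^ (K + 6) with hδ
  have hκ0 : 0 < 1 - Real.exp (-(1 / 128) : ℝ) := sub_pos.2 (Real.exp_lt_one_iff.2 (by norm_num))
  have hκ1 : 1 - Real.exp (-(1 / 128) : ℝ) < 1 := sub_lt_self _ (Real.exp_pos _)
  have hδ0 : 0 < δ := by positivity
  have hδ1 : δ < 1 := by
    have h1 : ((1 : ℝ) / 256) ^ K ≤ 1 := pow_le_one₀ (by norm_num) (by norm_num)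
    have h2 : (1 - Real.exp (-(1 / 128) : ℝ)) ^ (K + 6) < 1 :=
      pow_lt_one₀ hκ0.le hκ1 (by omega)
    exact mul_lt_one_of_nonneg_of_lt_one_right h1 (by positivity) h2
  have hlog : Real.log (1 - δ) < 0 := Real.log_neg (by linarith) (by linarith)
  have hc₁ : min (1 / 2 ^ 14) (1 / (64 * (K : ℝ))) * K < 1 / 32 := by
    calc min (1 / 2 ^ 14) (1 / (64 * (K : ℝ))) * K ≤ 1 / (64 * (K : ℝ)) * K := by
          gcongr; exact min_le_right _ _
      _ = 1 / 64 := by field_simp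
      _ < 1 / 32 := by norm_num
  have hc₂0 : 0 < min (1 / (2 ^ 14 * 10000) / 2) (-Real.log (1 - δ) / K) :=
    lt_min (by norm_num) (div_pos (by linarith) hK0)
  have hc₂ : 1 - Real.exp (-(min (1 / (2 ^ 14 * 10000) / 2) (-Real.log (1 - δ) / K) * K)) ≤ δ := by
    have h1 : min (1 / (2 ^ 14 * 10000) / 2) (-Real.log (1 - δ) / K) * K ≤ -Real.log (1 - δ) := by
      calc _ ≤ -Real.log (1 - δ) / K * K := by gcongr; exact min_le_right _ _
        _ = _ := by field_simp
    have h2 : 1 - δ ≤ Real.exp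
        (-(min (1 / (2 ^ 14 * 10000) / 2) (-Real.log (1 - δ) / K) * K)) := by
      rw [← Real.exp_log (show 0 < 1 - δ by linarith)]
      apply Real.exp_le_exp.2
      rw [Real.exp_log (show 0 < 1 - δ by linarith)]
      linarith
    linarith
  refine ⟨min (1 / 2 ^ 14) (1 / (64 * (K : ℝ))),
    min (1 / (2 ^ 14 * 10000) / 2) (-Real.log (1 - δ) / K), 64,
    lt_min (by norm_num) (by positivity), hc₂0, by norm_num, ?_⟩
  intro k _ ε hε hεk n hn
  exact ⟨DistributedCounting.le_toReal_large_error (by exact_mod_cast hK160) hKa (min_le_left _ _)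
      hc₁ hc₂0.le (min_le_left _ _) hc₂ hε hεk hn (Or.inl rfl),
    DistributedCounting.le_toReal_large_error (by exact_mod_cast hK160) hKa (min_le_left _ _)
      hc₁ hc₂0.le (min_le_left _ _) hc₂ hε hεk hn (Or.inr rfl)⟩
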